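/- Let $G$ be a finite graph without loops, in which parallel edges are allowed, and suppose that $G$ has maximum degree at most $3$. A star edge-coloring of $G$ is an assignment of colors to the edges such that any two distinct edges with a common end receive different colors and no path and no cycle of length four (that is, with four edges) in $G$ is colored with only two colors. Then $G$ is star $7$-edge-choosable: for every assignment of a finite list $L(e)$ of colors to each edge $e$ of $G$ with $|L(e)|\ge 7$ for all $e$, there is a star edge-coloring $\sigma$ of $G$ with $\sigma(e)\in L(e)$ for every edge $e$. Equivalently, the list star chromatic index of $G$, i.e. the least $k$ such that $G$ has a star edge-coloring from every assignment of finite lists of at least $k$ colors to its edges, is at most $7$. -/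

import Mathlib

universe u v w

namespace Graph

variable {α : Type u} {β : Type v}

/-- The degree of a vertex of a multigraph: the number of edges incident with it, where a loop
counts twice. -/
noncomputable def degree (G : Graph α β) (x : α) : ℕ∞ :=
  (G.incidenceSet x).encard + (G.loopSet x).encard

/-- The maximum degree of a multigraph (`0` if it has no vertices). -/
noncomputable def maxDegree (G : Graph α β) : ℕ∞ :=
  ⨆ x ∈ G.vertexSet, G.degree x

/-- The edges `e 0, e 1, e 2, e 3` form, in this order, a path of length four: its five vertices
are pairwise distinct (hence so are its edges). -/
def IsFourPath (G : Graph α β) (e : Fin 4 → G.edgeSet) : Prop :=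
  ∃ x : Fin 5 → α, Function.Injective x ∧ ∀ i : Fin 4, G.IsLink (e i) (x i.castSucc) (x i.succ)

/-- The edges `e 0, e 1, e 2, e 3` form, in this cyclic order, a cycle of length four: its four
vertices are pairwise distinct (hence so are its edges). The sum `i + 1` is taken modulo `4`. -/
def IsFourCycle (G : Graph α β) (e : Fin 4 → G.edgeSet) : Prop :=
  ∃ x : Fin 4 → α, Function.Injective x ∧ ∀ i : Fin 4, G.IsLink (e i) (x i) (x (i + 1))

/-- A proper edge-coloring: any two distinct edges with a common end (in particular any two
parallel edges) have different colors. -/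
def IsProperEdgeColoring (G : Graph α β) {C : Type w} (σ : G.edgeSet → C) : Prop :=
  ∀ (e f : G.edgeSet) (x : α), e ≠ f → G.Inc e x → G.Inc f x → σ e ≠ σ f

/-- The edges `e 0, e 1, e 2, e 3` receive at most two colors. (In a proper coloring the edges of
a path or cycle receive at least two colors, so then this means exactly two.) -/
def IsBichromatic {G : Graph α β} {C : Type w} (σ : G.edgeSet → C) (e : Fin 4 → G.edgeSet) :
    Prop :=
  ∃ a b : C, ∀ i : Fin 4, σ (e i) = a ∨ σ (e i) = b

/-- A star edge-coloring: a proper edge-coloring with neither a bichromatic path nor a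
bichromatic cycle of length four. -/
structure IsStarEdgeColoring (G : Graph α β) {C : Type w} (σ : G.edgeSet → C) : Prop where
  proper : G.IsProperEdgeColoring σ
  not_path : ∀ e : Fin 4 → G.edgeSet, G.IsFourPath e → ¬ IsBichromatic σ e
  not_cycle : ∀ e : Fin 4 → G.edgeSet, G.IsFourCycle e → ¬ IsBichromatic σ e

/-- `G` is star `L`-edge-colorable: it has a star edge-coloring that gives each edge `e` a color
from its list `L e`. -/
def IsStarListEdgeColorable (G : Graph α β) {C : Type w} (L : G.edgeSet → Finset C) : Prop :=
  ∃ σ : G.edgeSet → C, G.IsStarEdgeColoring σ ∧ ∀ e, σ e ∈ L e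

/-- `G` is star `k`-edge-choosable: it is star `L`-edge-colorable for every edge-list-assignment
`L` all of whose lists have at least `k` colors, whatever the type `C` of colors is. -/
def IsStarEdgeChoosable (G : Graph α β) (k : ℕ) : Prop :=
  ∀ (C : Type w) (L : G.edgeSet → Finset C), (∀ e, k ≤ (L e).card) → G.IsStarListEdgeColorable L

/-- The list star chromatic index of `G`: the least `k` such that `G` is star `k`-edge-choosable
(`⊤` if there is no such `k`). -/
noncomputable def listStarChromaticIndex (G : Graph α β) : ℕ∞ :=
  ⨅ (k : ℕ) (_ : IsStarEdgeChoosable.{u, v, w} G k), (k : ℕ∞)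

end Graph

/-!
Delete a perfect matching `M` from a cubic multigraph: what remains is a disjoint union of cycles.
Color the edges of `M` first, greedily and so that each of them differs from every other edge of `M`
which it touches or to which it is joined by an edge; then no bichromatic path or cycle of length
four uses an edge of `M`. Since an edge has at most four such neighbors in `M`, every remaining edge
keeps at least `3` of its `7` colors, and a cycle can be colored from lists of size `3`, except that
a `5`-cycle fails when all its lists are equal. While coloring `M`, these bad `5`-cycles are avoided
by excluding at most one further color for each end of the edge being colored.

A general subcubic multigraph need not have such a matching. Take instead a minimal nonempty set `Y`
of vertices which at most one edge leaves. By minimality, Tutte's theorem gives a matching which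
contains the leaving edge and covers all cubic vertices of `Y`. The rest of the graph is colored by
induction, then the leaving edge, and then the inside of `Y` as above.
-/

open scoped Finset

namespace StarEdgeColoring

variable {V E C : Type*}

/-! ### Colorings of a cycle -/

section CycleColoring

variable {n : ℕ}

/-- A star edge-coloring of the cycle of length `n`, with edges indexed cyclically by `ZMod n`:
cyclically consecutive colors differ, and no four cyclically consecutive colors alternate. -/
structure IsStarCycleColoring (c : ZMod n → C) : Prop where
  ne : ∀ i, c i ≠ c (i + 1)
  not_alternating : 4 ≤ n → ∀ i, ¬ (c i = c (i + 2) ∧ c (i + 1) = c (i + 3))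

theorem IsStarCycleColoring.comp_injective {D : Type*} {c : ZMod n → C}
    (hc : IsStarCycleColoring c) {φ : C → D} (hφ : φ.Injective) :
    IsStarCycleColoring (φ ∘ c) where
  ne i := hφ.ne (hc.ne i)
  not_alternating h i := fun ⟨h₁, h₂⟩ => hc.not_alternating h i ⟨hφ h₁, hφ h₂⟩

theorem IsStarCycleColoring.comp_add_right {c : ZMod n → C} (hc : IsStarCycleColoring c)
    (k : ZMod n) : IsStarCycleColoring fun i => c (i + k) where
  ne i := by simpa only [add_right_comm] using hc.ne (i + k)
  not_alternating h i := by simpa only [add_right_comm] using hc.not_alternating h (i + k)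

theorem val_add_natCast {k : ℕ} (hk : k < n) (i : ZMod n) :
    (i + (k : ZMod n)).val = if i.val + k < n then i.val + k else i.val + k - n := by
  have : NeZero n := ⟨by lia⟩
  have hval : (k : ZMod n).val = k := ZMod.val_natCast_of_lt hk
  split_ifs with h
  · rw [ZMod.val_add_of_lt (by rwa [hval]), hval]
  · rw [ZMod.val_add_of_le (by rw [hval]; lia), hval]

theorem isStarCycleColoring_comp_val (hn : 2 ≤ n) {d : ℕ → C}
    (ne : ∀ i, i + 1 < n → d i ≠ d (i + 1)) (ne_wrap : d (n - 1) ≠ d 0)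
    (not_alternating : 4 ≤ n → ∀ i, i + 3 < n → ¬ (d i = d (i + 2) ∧ d (i + 1) = d (i + 3)))
    (not_alternating_wrap : 4 ≤ n → ¬ (d (n - 3) = d (n - 1) ∧ d (n - 2) = d 0) ∧
      ¬ (d (n - 2) = d 0 ∧ d (n - 1) = d 1) ∧ ¬ (d (n - 1) = d 1 ∧ d 0 = d 2)) :
    IsStarCycleColoring fun i : ZMod n => d i.val where
  ne i := by
    have : NeZero n := ⟨by lia⟩
    have hi := i.val_lt
    have h₁ := val_add_natCast (k := 1) (by lia) i
    rw [Nat.cast_one] at h₁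
    rw [h₁]
    split_ifs with h
    · exact ne _ h
    · rwa [show i.val = n - 1 by lia, show n - 1 + 1 - n = 0 by lia]
  not_alternating h i := by
    have : NeZero n := ⟨by lia⟩
    have hi := i.val_lt
    obtain ⟨w₁, w₂, w₃⟩ := not_alternating_wrap h
    have h₁ := val_add_natCast (k := 1) (by lia) i
    have h₂ := val_add_natCast (k := 2) (by lia) i
    have h₃ := val_add_natCast (k := 3) (by lia) i
    rw [Nat.cast_one] at h₁
    rw [Nat.cast_ofNat] at h₂ h₃
    rw [h₁, h₂, h₃]
    obtain h | h | h | h : i.val + 3 < n ∨ i.val = n - 3 ∨ i.val = n - 2 ∨ i.val = n - 1 := by lia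
    · rw [if_pos (by lia), if_pos (by lia), if_pos h]
      exact not_alternating ‹_› _ h
    · rwa [h, if_pos (by lia), if_pos (by lia), if_neg (by lia), show n - 3 + 1 = n - 2 by lia,
        show n - 3 + 2 = n - 1 by lia, show n - 3 + 3 - n = 0 by lia]
    · rwa [h, if_neg (by lia), if_pos (by lia), if_neg (by lia), show n - 2 + 1 = n - 1 by lia,
        show n - 2 + 2 - n = 0 by lia, show n - 2 + 3 - n = 1 by lia]
    · rwa [h, if_neg (by lia), if_neg (by lia), if_neg (by lia), show n - 1 + 1 - n = 0 by lia,
        show n - 1 + 2 - n = 1 by lia, show n - 1 + 3 - n = 2 by lia]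

theorem exists_isStarCycleColoring_fin_three (hn : 2 ≤ n) (h₅ : n ≠ 5) :
    ∃ c : ZMod n → Fin 3, IsStarCycleColoring c := by
  -- The word `0102` repeated `n % 3` times, followed by repetitions of `012`.
  let d (i : ℕ) : Fin 3 :=
    ⟨if i < 4 * (n % 3) then if i % 2 = 0 then 0 else (i % 4 + 1) / 2 else (i + 2 * (n % 3)) % 3,
      by split_ifs <;> lia⟩
  refine ⟨_, isStarCycleColoring_comp_val (d := d) hn (fun i _ => ?_) ?_ (fun _ i _ => ?_)
    fun _ => ⟨?_, ?_, ?_⟩⟩ <;>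
    simp only [d, ne_eq, Fin.mk.injEq, not_and] <;> split_ifs <;> omega

theorem exists_isStarCycleColoring_fin_four : ∃ c : ZMod 5 → Fin 4, IsStarCycleColoring c :=
  ⟨![0, 1, 0, 2, 3], by unfold ZMod; decide, by unfold ZMod; decide⟩

theorem exists_isStarCycleColoring_const (hn : 2 ≤ n) {A : Finset C} (hA : 3 ≤ #A)
    (h₅ : n = 5 → 4 ≤ #A) : ∃ c : ZMod n → C, IsStarCycleColoring c ∧ ∀ i, c i ∈ A := by
  obtain ⟨k, hk, c, hc⟩ : ∃ k ≤ #A, ∃ c : ZMod n → Fin k, IsStarCycleColoring c := by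
    by_cases hn₅ : n = 5
    · subst hn₅
      exact ⟨4, h₅ rfl, exists_isStarCycleColoring_fin_four⟩
    · exact ⟨3, hA, exists_isStarCycleColoring_fin_three hn hn₅⟩
  let φ : Fin k → C := fun j => A.equivFin.symm (j.castLE hk)
  have hφ : φ.Injective :=
    Subtype.val_injective.comp (A.equivFin.symm.injective.comp (Fin.castLE_injective hk))
  exact ⟨φ ∘ c, hc.comp_injective hφ, fun i => Subtype.coe_prop _⟩

theorem exists_seq_of_exists_second_order {P : ℕ → C → C → C → Prop}
    (hP : ∀ i p q, ∃ r, P i p q r) (a b : C) :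
    ∃ c : ℕ → C, c 0 = a ∧ c 1 = b ∧ ∀ i, P i (c i) (c (i + 1)) (c (i + 2)) := by
  choose next hnext using hP
  let pair : ℕ → C × C := fun i => Nat.rec (a, b) (fun i p => (p.2, next i p.1 p.2)) i
  exact ⟨fun i => (pair i).1, rfl, rfl, fun i => hnext i _ _⟩

/- Greedily avoid the two preceding colors. The first color `a` is absent from the last list, which
settles the two windows ending at the last edge and at the first one; for the remaining wrapping
window, the color at position `n - 2` avoids `a` instead of the color at position `n - 4`. -/
theorem exists_isStarCycleColoring_of_notMem (hn : 2 ≤ n) {R : ZMod n → Finset C}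
    (hR : ∀ i, 3 ≤ #(R i)) {a : C} (ha : a ∈ R 0) (ha' : a ∉ R (-1)) :
    ∃ c : ZMod n → C, IsStarCycleColoring c ∧ ∀ i, c i ∈ R i := by
  classical
  have exists_mem_ne (i : ZMod n) (p q : C) : ∃ r ∈ R i, r ≠ p ∧ r ≠ q := by
    obtain ⟨r, hr, hpq⟩ := Finset.exists_mem_notMem_of_card_lt_card
      ((Finset.card_le_two (a := p) (b := q)).trans_lt (hR i))
    exact ⟨r, hr, by simpa only [Finset.mem_insert, Finset.mem_singleton, not_or] using hpq⟩
  obtain ⟨b, hb, hba, -⟩ := exists_mem_ne 1 a a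
  obtain ⟨c, rfl, rfl, hc⟩ := exists_seq_of_exists_second_order
    (fun (i : ℕ) p q => exists_mem_ne ((i + 2 : ℕ) : ZMod n) q (if i + 4 = n then a else p)) a b
  have mem : ∀ i : ℕ, c i ∈ R i
    | 0 => by simpa using ha
    | 1 => by simpa using hb
    | i + 2 => (hc i).1
  have ne : ∀ i, c i ≠ c (i + 1)
    | 0 => hba.symm
    | i + 1 => (hc i).2.1.symm
  have avoid (i : ℕ) (hi : i + 4 ≠ n) : c (i + 2) ≠ c i := by simpa [hi] using (hc i).2.2
  have avoid_first (h : 4 ≤ n) : c (n - 2) ≠ c 0 := by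
    simpa [show n - 4 + 4 = n by lia, show n - 4 + 2 = n - 2 by lia] using (hc (n - 4)).2.2
  have last_ne : c (n - 1) ≠ c 0 := fun h => ha' <| by
    simpa [h, Nat.cast_sub (show 1 ≤ n by lia)] using mem (n - 1)
  refine ⟨fun i => c i.val, isStarCycleColoring_comp_val hn (fun i _ => ne i) last_ne
    (fun _ i _ h => ?_) (fun h => ⟨fun h' => avoid_first h h'.2, fun h' => avoid_first h h'.1,
      fun h' => ?_⟩), fun i => ?_⟩
  · by_cases hi₄ : i + 4 = n
    · exact avoid (i + 1) (by lia) h.2.symm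
    · exact avoid i hi₄ h.1.symm
  · obtain rfl | hn₄ := h.eq_or_lt
    · exact avoid_first h h'.2.symm
    · exact avoid 0 (by lia) h'.2.symm
  · have : NeZero n := ⟨by lia⟩
    simpa using mem i.val

theorem exists_isStarCycleColoring (hn : 2 ≤ n) {R : ZMod n → Finset C} (hR : ∀ i, 3 ≤ #(R i))
    (h₅ : n = 5 → ¬ ∃ A, #A = 3 ∧ ∀ i, R i = A) :
    ∃ c : ZMod n → C, IsStarCycleColoring c ∧ ∀ i, c i ∈ R i := by
  have : NeZero n := ⟨by lia⟩
  by_cases h : ∀ i, R i ⊆ R (i - 1)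
  · have subset_sub (i : ZMod n) (k : ℕ) : R i ⊆ R (i - k) := by
      induction k with
      | zero => simp
      | succ k ih => exact ih.trans (by simpa [sub_sub] using h (i - k))
    have subset (i j : ZMod n) : R i ⊆ R j := by simpa using subset_sub i (i - j).val
    have const (i : ZMod n) : R i = R 0 := (subset i 0).antisymm (subset 0 i)
    simp only [const] at h₅ ⊢
    exact exists_isStarCycleColoring_const hn (hR 0) fun h =>
      (hR 0).lt_of_ne fun h' => h₅ h ⟨_, h'.symm, fun _ => rfl⟩
  · push Not at h
    obtain ⟨i₀, h⟩ := h
    obtain ⟨a, ha, ha'⟩ := Finset.not_subset.mp h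
    obtain ⟨c, hc, hcR⟩ := exists_isStarCycleColoring_of_notMem hn (R := fun i => R (i + i₀))
      (fun i => hR _) (by rwa [zero_add]) (by rwa [neg_add_eq_sub])
    refine ⟨_, hc.comp_add_right (-i₀), fun i => ?_⟩
    simpa only [neg_add_cancel_right] using hcR (i + -i₀)

end CycleColoring

/-! ### Star colorings of sets of edges -/

section EdgeSets

/-- Two edges touch if they have a common end. In particular, every edge touches itself. -/
def Touch (ends : E → Sym2 V) (e f : E) : Prop := ∃ x, x ∈ ends e ∧ x ∈ ends f

open Classical in
/-- The set of edges in `S` incident with the vertex `x`. -/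
noncomputable def edgesAt (ends : E → Sym2 V) (S : Finset E) (x : V) : Finset E :=
  {e ∈ S | x ∈ ends e}

/-- The subgraph with edge set `S` has maximum degree at most `k` (in the absence of loops). -/
def DegreeLE (ends : E → Sym2 V) (S : Finset E) (k : ℕ) : Prop := ∀ x, #(edgesAt ends S x) ≤ k

/-- The edges `a`, `b`, `c`, `d` are the consecutive edges of a trail in which `a` and `d` may
share their outer ends with any vertex of the trail. The trails that are neither paths nor cycles
do not matter: there the condition `IsStarOn.quad` follows from properness. -/
def IsQuad (ends : E → Sym2 V) (a b c d : E) : Prop :=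
  ∃ x y z, x ∈ ends a ∧ ends b = s(x, y) ∧ ends c = s(y, z) ∧ z ∈ ends d ∧
    a ≠ b ∧ b ≠ c ∧ c ≠ d ∧ a ≠ c ∧ b ≠ d

/-- `σ` restricts to a star edge-coloring of the subgraph with edge set `S`. -/
structure IsStarOn (ends : E → Sym2 V) (S : Finset E) (σ : E → C) : Prop where
  ne : ∀ a ∈ S, ∀ b ∈ S, a ≠ b → Touch ends a b → σ a ≠ σ b
  quad : ∀ a ∈ S, ∀ b ∈ S, ∀ c ∈ S, ∀ d ∈ S, IsQuad ends a b c d → σ a = σ c → σ b ≠ σ d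

open Classical in
/-- The edges of `S`, other than `e`, at distance at most two from `e` in the subgraph with edge
set `D`. -/
noncomputable def near (ends : E → Sym2 V) (D S : Finset E) (e : E) : Finset E :=
  {h ∈ S | h ≠ e ∧ ∃ g ∈ D, Touch ends e g ∧ Touch ends g h}

/-- In `S`, no other edge at distance at most two from `e` has the color of `e`. -/
def IsStrongAt (ends : E → Sym2 V) (S : Finset E) (σ : E → C) (e : E) : Prop :=
  ∀ h ∈ near ends S S e, σ h ≠ σ e

variable {ends : E → Sym2 V} {D S T : Finset E} {σ τ : E → C} {e f : E} {k s : ℕ}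

theorem Touch.refl (e : E) : Touch ends e e := by
  obtain ⟨x, hx⟩ : ∃ x, x ∈ ends e := (ends e).ind fun x y => ⟨x, Sym2.mem_mk_left x y⟩
  exact ⟨x, hx, hx⟩

theorem Touch.symm (h : Touch ends e f) : Touch ends f e :=
  let ⟨x, he, hf⟩ := h
  ⟨x, hf, he⟩

theorem IsQuad.touch {a b c d : E} (h : IsQuad ends a b c d) :
    Touch ends a b ∧ Touch ends b c ∧ Touch ends c d := by
  obtain ⟨x, y, z, hxa, hxy, hyz, hzd, -⟩ := h
  exact ⟨⟨x, hxa, by simp [hxy]⟩, ⟨y, by simp [hxy], by simp [hyz]⟩, z, by simp [hyz], hzd⟩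

theorem IsQuad.ne {a b c d : E} (h : IsQuad ends a b c d) : a ≠ c ∧ b ≠ d := by
  obtain ⟨-, -, -, -, -, -, -, -, -, -, h⟩ := h
  exact h

theorem mem_edgesAt {x : V} : e ∈ edgesAt ends S x ↔ e ∈ S ∧ x ∈ ends e := by simp [edgesAt]

theorem edgesAt_mono (h : S ⊆ T) (x : V) : edgesAt ends S x ⊆ edgesAt ends T x :=
  fun _ he => mem_edgesAt.mpr ((mem_edgesAt.mp he).imp_left (@h _))

theorem DegreeLE.mono (hT : DegreeLE ends T k) (h : S ⊆ T) : DegreeLE ends S k :=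
  fun x => (Finset.card_le_card (edgesAt_mono h x)).trans (hT x)

theorem DegreeLE.eq_of_mem (hS : DegreeLE ends S 1) {x : V} (he : e ∈ S) (hf : f ∈ S)
    (hxe : x ∈ ends e) (hxf : x ∈ ends f) : e = f :=
  Finset.card_le_one.mp (hS x) _ (mem_edgesAt.mpr ⟨he, hxe⟩) _ (mem_edgesAt.mpr ⟨hf, hxf⟩)

theorem mem_near :
    f ∈ near ends D S e ↔ f ∈ S ∧ f ≠ e ∧ ∃ g ∈ D, Touch ends e g ∧ Touch ends g f := by
  simp [near]

theorem near_mono {D' S' : Finset E} (hD : D ⊆ D') (hS : S ⊆ S') :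
    near ends D S e ⊆ near ends D' S' e := fun h hh => by
  obtain ⟨hhS, hne, g, hg, heg, hgh⟩ := mem_near.mp hh
  exact mem_near.mpr ⟨hS hhS, hne, g, hD hg, heg, hgh⟩

theorem near_comm (he : e ∈ S) (hf : f ∈ T) : f ∈ near ends D T e ↔ e ∈ near ends D S f := by
  simp only [mem_near, he, hf, true_and, ne_comm (a := f)]
  exact and_congr_right fun _ => exists_congr fun g =>
    and_congr_right fun _ => ⟨fun h => ⟨h.2.symm, h.1.symm⟩, fun h => ⟨h.2.symm, h.1.symm⟩⟩

theorem IsStarOn.congr (hσ : IsStarOn ends S σ) (h : ∀ e ∈ S, σ e = τ e) : IsStarOn ends S τ where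
  ne a ha b hb := by simpa only [← h a ha, ← h b hb] using hσ.ne a ha b hb
  quad a ha b hb c hc d hd := by
    simpa only [← h a ha, ← h b hb, ← h c hc, ← h d hd] using hσ.quad a ha b hb c hc d hd

theorem IsStarOn.mono (hσ : IsStarOn ends T σ) (h : S ⊆ T) : IsStarOn ends S σ where
  ne a ha b hb := hσ.ne a (h ha) b (h hb)
  quad a ha b hb c hc d hd := hσ.quad a (h ha) b (h hb) c (h hc) d (h hd)

theorem IsStrongAt.congr (hσ : IsStrongAt ends S σ e) (he : e ∈ S) (h : ∀ f ∈ S, σ f = τ f) :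
    IsStrongAt ends S τ e := fun f hf => by
  rw [← h e he, ← h f (mem_near.mp hf).1]
  exact hσ f hf

theorem IsStrongAt.ne (hσ : IsStrongAt ends S σ e) {g : E} (hf : f ∈ S) (hg : g ∈ S)
    (hfe : f ≠ e) (heg : Touch ends e g) (hgf : Touch ends g f) : σ f ≠ σ e :=
  hσ f (mem_near.mpr ⟨hf, hfe, g, hg, heg, hgf⟩)

theorem isStarOn_of_isStrongAt [DecidableEq E] (hP : ∀ e ∈ T, IsStrongAt ends S σ e)
    (hσ : IsStarOn ends (S \ T) σ) : IsStarOn ends S σ where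
  ne a ha b hb hab hT := by
    by_cases haT : a ∈ T
    · exact ((hP a haT).ne hb hb hab.symm hT (.refl b)).symm
    by_cases hbT : b ∈ T
    · exact (hP b hbT).ne ha ha hab hT.symm (.refl a)
    exact hσ.ne a (by simp [*]) b (by simp [*]) hab hT
  quad a ha b hb c hc d hd hQ hac := by
    obtain ⟨⟨hab, hbc, hcd⟩, hac', hbd⟩ := And.intro hQ.touch hQ.ne
    by_cases haT : a ∈ T
    · exact ((hP a haT).ne hc hb hac'.symm hab hbc hac.symm).elim
    by_cases hcT : c ∈ T
    · exact ((hP c hcT).ne ha hb hac' hbc.symm hab.symm hac).elim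
    by_cases hbT : b ∈ T
    · exact ((hP b hbT).ne hd hc hbd.symm hbc hcd).symm
    by_cases hdT : d ∈ T
    · exact (hP d hdT).ne hb hc hbd hcd.symm hbc.symm
    exact hσ.quad a (by simp [*]) b (by simp [*]) c (by simp [*]) d (by simp [*]) hQ hac

theorem IsStarOn.update [DecidableEq E] (hσ : IsStarOn ends S σ) (he : e ∉ S) (z : C) :
    IsStarOn ends S (Function.update σ e z) :=
  hσ.congr fun _ hf => (Function.update_of_ne (ne_of_mem_of_not_mem hf he) z σ).symm

theorem exists_isStrongAt_update [DecidableEq E] (σ : E → C) {R : Finset C}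
    (hR : #(near ends S S e) < #R) : ∃ z ∈ R, IsStrongAt ends S (Function.update σ e z) e := by
  classical
  obtain ⟨z, hz, hzσ⟩ := Finset.exists_mem_notMem_of_card_lt_card
    ((Finset.card_image_le (f := σ)).trans_lt hR)
  refine ⟨z, hz, fun f hf => ?_⟩
  rw [Function.update_self, Function.update_of_ne (mem_near.mp hf).2.1]
  exact fun h => hzσ (h ▸ Finset.mem_image_of_mem σ hf)

theorem IsStarOn.exists_update [DecidableEq E] (hσ : IsStarOn ends (S.erase e) σ) {R : Finset C}
    (hR : #(near ends S S e) < #R) : ∃ z ∈ R, IsStarOn ends S (Function.update σ e z) := by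
  obtain ⟨z, hz, hstrong⟩ := exists_isStrongAt_update σ hR
  refine ⟨z, hz, isStarOn_of_isStrongAt (T := {e}) (by simpa using hstrong) ?_⟩
  rw [Finset.sdiff_singleton_eq_erase]
  exact hσ.update (Finset.notMem_erase e S) z

theorem isStarOn_union [DecidableEq E] (hS : IsStarOn ends S σ) (hT : IsStarOn ends T σ)
    (hST : ∀ e ∈ S, ∀ f ∈ T, ¬ Touch ends e f) : IsStarOn ends (S ∪ T) σ where
  ne a ha b hb hab h := by
    have hTS := fun e he f hf h => hST f hf e he (Touch.symm h)
    grind [hS.ne a, hT.ne a]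
  quad a ha b hb c hc d hd hQ := by
    obtain ⟨hab, hbc, hcd⟩ := hQ.touch
    have hTS := fun e he f hf h => hST f hf e he (Touch.symm h)
    grind [hS.quad a, hT.quad a]

theorem exists_card_le_of_touch (hSD : S ⊆ D) (he : e ∈ D) (hD : DegreeLE ends D (k + 1))
    (hS : DegreeLE ends S s) {x : V} (hx : x ∈ ends e) :
    ∃ N : Finset E, #N ≤ k * s ∧
      ∀ h ∈ S, h ≠ e → ∀ g ∈ D, g ≠ e → x ∈ ends g → Touch ends g h → h ∈ N := by
  classical
  let others := (edgesAt ends D x).erase e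
  have card_others : #others ≤ k := by
    rw [Finset.card_erase_of_mem (mem_edgesAt.mpr ⟨he, hx⟩)]
    exact Nat.sub_le_iff_le_add.mpr (hD x)
  have : ∀ g, ∃ y, x ∈ ends g → ends g = s(x, y) := fun g => by
    by_cases hxg : x ∈ ends g
    · obtain ⟨y, hy⟩ := Sym2.mem_iff_exists.mp hxg
      exact ⟨y, fun _ => hy⟩
    · exact ⟨x, fun h => (hxg h).elim⟩
  choose other hother using this
  refine ⟨others.biUnion fun g => edgesAt ends S (other g),
    (Finset.card_biUnion_le_card_mul _ _ _ fun g _ => hS _).trans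
      (Nat.mul_le_mul_right _ card_others), fun h hh hhe g hg hge hxg ⟨z, hzg, hzh⟩ => ?_⟩
  simp only [Finset.mem_biUnion]
  rw [hother g hxg, Sym2.mem_iff] at hzg
  obtain rfl | rfl := hzg
  · refine ⟨h, Finset.mem_erase.mpr ⟨hhe, mem_edgesAt.mpr ⟨hSD hh, hzh⟩⟩, mem_edgesAt.mpr ⟨hh, ?_⟩⟩
    simp [hother h hzh]
  · exact ⟨g, Finset.mem_erase.mpr ⟨hge, mem_edgesAt.mpr ⟨hg, hxg⟩⟩, mem_edgesAt.mpr ⟨hh, hzh⟩⟩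

theorem exists_touch_of_mem_near (hSD : S ⊆ D) (hf : f ∈ near ends D S e) :
    ∃ g ∈ D, g ≠ e ∧ Touch ends e g ∧ Touch ends g f := by
  obtain ⟨hfS, hfe, g, hg, heg, hgf⟩ := mem_near.mp hf
  by_cases hge : g = e
  · exact ⟨f, hSD hfS, hfe, hge ▸ hgf, .refl f⟩
  · exact ⟨g, hg, hge, heg, hgf⟩

theorem card_near_le (hSD : S ⊆ D) (he : e ∈ D) (hD : DegreeLE ends D (k + 1))
    (hS : DegreeLE ends S s) : #(near ends D S e) ≤ 2 * (k * s) := by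
  classical
  obtain ⟨u, w, huw⟩ : ∃ u w, ends e = s(u, w) := (ends e).ind fun u w => ⟨u, w, rfl⟩
  obtain ⟨N, hN, hNu⟩ := exists_card_le_of_touch hSD he hD hS (x := u) (by simp [huw])
  obtain ⟨N', hN', hNw⟩ := exists_card_le_of_touch hSD he hD hS (x := w) (by simp [huw])
  have hsub : near ends D S e ⊆ N ∪ N' := fun f hf => by
    obtain ⟨hfS, hfe, -⟩ := mem_near.mp hf
    obtain ⟨g, hg, hge, ⟨x, hxe, hxg⟩, hgf⟩ := exists_touch_of_mem_near hSD hf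
    rw [huw, Sym2.mem_iff] at hxe
    obtain rfl | rfl := hxe
    · exact Finset.mem_union_left _ (hNu f hfS hfe g hg hge hxg hgf)
    · exact Finset.mem_union_right _ (hNw f hfS hfe g hg hge hxg hgf)
  have := (Finset.card_le_card hsub).trans (Finset.card_union_le N N')
  lia

theorem card_near_le_of_leaf (hSD : S ⊆ D) (he : e ∈ D) (hD : DegreeLE ends D (k + 1))
    (hS : DegreeLE ends S s) {u : V} (hu : u ∈ ends e) (hleaf : ∀ g ∈ D, u ∈ ends g → g = e) :
    #(near ends D S e) ≤ k * s := by
  obtain ⟨w, hw⟩ := Sym2.mem_iff_exists.mp hu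
  obtain ⟨N, hN, hNw⟩ := exists_card_le_of_touch hSD he hD hS (x := w) (by simp [hw])
  refine (Finset.card_le_card fun f hf => ?_).trans hN
  obtain ⟨hfS, hfe, -⟩ := mem_near.mp hf
  obtain ⟨g, hg, hge, ⟨x, hxe, hxg⟩, hgf⟩ := exists_touch_of_mem_near hSD hf
  rw [hw, Sym2.mem_iff] at hxe
  obtain rfl | rfl := hxe
  · exact (hge (hleaf g hg hxg)).elim
  · exact hNw f hfS hfe g hg hge hxg hgf

end EdgeSets

/-! ### Edge sets of maximum degree two -/

section ClosedTrail

variable {ends : E → Sym2 V} {F : Finset E} {n : ℕ} {x : ZMod n → V} {f : ZMod n → E}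

/-- The vertices `x i` and the distinct edges `f i`, both indexed cyclically by `ZMod n`, form a
closed trail, in which `f i` joins `x i` to `x (i + 1)`. -/
structure IsClosedTrail (ends : E → Sym2 V) (x : ZMod n → V) (f : ZMod n → E) : Prop where
  link : ∀ i, ends (f i) = s(x i, x (i + 1))
  injective : f.Injective

namespace IsClosedTrail

theorem left_mem (h : IsClosedTrail ends x f) (i : ZMod n) : x i ∈ ends (f i) := by
  simp [h.link]

theorem right_mem (h : IsClosedTrail ends x f) (i : ZMod n) : x (i + 1) ∈ ends (f i) := by
  simp [h.link]

theorem eq_of_mem (h : IsClosedTrail ends x f) (hn : 2 ≤ n) (hF : DegreeLE ends F 2)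
    (hf : ∀ i, f i ∈ F) {i : ZMod n} {g : E} (hg : g ∈ F) (hx : x i ∈ ends g) :
    g = f (i - 1) ∨ g = f i := by
  classical
  have : Fact (1 < n) := ⟨hn⟩
  by_contra! hne
  have hpred : x i ∈ ends (f (i - 1)) := by simpa using h.right_mem (i - 1)
  have hsub : {g, f (i - 1), f i} ⊆ edgesAt ends F (x i) := by
    simp [Finset.insert_subset_iff, mem_edgesAt, hg, hx, hf, hpred, h.left_mem]
  have hcard : #{g, f (i - 1), f i} = 3 :=
    Finset.card_eq_three.mpr ⟨_, _, _, hne.1, hne.2, h.injective.ne (by simp), rfl⟩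
  have := (Finset.card_le_card hsub).trans (hF _)
  lia

theorem eq_of_touch (h : IsClosedTrail ends x f) (hn : 2 ≤ n) (hF : DegreeLE ends F 2)
    (hf : ∀ i, f i ∈ F) {i : ZMod n} {g : E} (hg : g ∈ F) (hT : Touch ends (f i) g) :
    g = f (i - 1) ∨ g = f i ∨ g = f (i + 1) := by
  obtain ⟨y, hy, hyg⟩ := hT
  rw [h.link, Sym2.mem_iff] at hy
  obtain rfl | rfl := hy
  · exact (h.eq_of_mem hn hF hf hg hyg).imp_right .inl
  · simpa using Or.inr (h.eq_of_mem hn hF hf hg hyg)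

theorem eq_of_isQuad (h : IsClosedTrail ends x f) (hn : 2 ≤ n) (hF : DegreeLE ends F 2)
    (hf : ∀ i, f i ∈ F) {a c d : E} {i : ZMod n} (ha : a ∈ F) (hc : c ∈ F) (hd : d ∈ F)
    (hQ : IsQuad ends a (f i) c d) :
    a = f (i - 1) ∧ c = f (i + 1) ∧ d = f (i + 2) ∨
      a = f (i + 1) ∧ c = f (i - 1) ∧ d = f (i - 2) := by
  obtain ⟨p, q, r, hpa, hpq, hqr, hrd, hab, hbc, hcd, -⟩ := hQ
  have hqc : q ∈ ends c := by simp [hqr]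
  rw [h.link, Sym2.eq_iff] at hpq
  obtain ⟨rfl, rfl⟩ | ⟨rfl, rfl⟩ := hpq
  · obtain rfl : c = f (i + 1) :=
      (h.eq_of_mem hn hF hf hc hqc).resolve_left (by simpa using hbc.symm)
    rw [h.link, Sym2.congr_right, add_assoc, one_add_one_eq_two] at hqr
    subst hqr
    refine .inl ⟨(h.eq_of_mem hn hF hf ha hpa).resolve_right hab, rfl,
      (h.eq_of_mem hn hF hf hd hrd).resolve_left fun hd' => hcd ?_⟩
    rw [hd', ← one_add_one_eq_two, ← add_assoc, add_sub_cancel_right]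
  · obtain rfl : c = f (i - 1) := (h.eq_of_mem hn hF hf hc hqc).resolve_right hbc.symm
    rw [h.link, sub_add_cancel, Sym2.eq_swap, Sym2.congr_right] at hqr
    subst hqr
    refine .inr ⟨(h.eq_of_mem hn hF hf ha hpa).resolve_left (by simpa using hab), rfl,
      ?_⟩
    rw [← one_add_one_eq_two, ← sub_sub]
    exact (h.eq_of_mem hn hF hf hd hrd).resolve_right hcd.symm

theorem isStarOn (h : IsClosedTrail ends x f) (hn : 2 ≤ n) (hF : DegreeLE ends F 2)
    (hf : ∀ g, g ∈ F ↔ ∃ i, f i = g) {σ : E → C} (hσ : IsStarCycleColoring (σ ∘ f)) :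
    IsStarOn ends F σ := by
  have hf' (i) : f i ∈ F := (hf _).mpr ⟨i, rfl⟩
  have ne_pred (i) : σ (f i) ≠ σ (f (i - 1)) := by simpa using (hσ.ne (i - 1)).symm
  refine ⟨fun a ha b hb hab hT => ?_, fun a ha b hb c hc d hd hQ hac hbd => ?_⟩
  · obtain ⟨i, rfl⟩ := (hf a).mp ha
    obtain rfl | rfl | rfl := h.eq_of_touch hn hF hf' hb hT
    exacts [ne_pred i, (hab rfl).elim, hσ.ne i]
  obtain ⟨i, rfl⟩ := (hf b).mp hb
  have hQ' := h.eq_of_isQuad hn hF hf' ha hc hd hQ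
  obtain ⟨hne, heq⟩ : f (i + 1) ≠ f (i - 1) ∧ σ (f (i + 1)) = σ (f (i - 1)) := by
    obtain ⟨rfl, rfl, -⟩ | ⟨rfl, rfl, -⟩ := hQ'
    exacts [⟨hQ.ne.1.symm, hac.symm⟩, ⟨hQ.ne.1, hac⟩]
  obtain rfl | rfl | hn₄ : n = 2 ∨ n = 3 ∨ 4 ≤ n := by lia
  · exact hne (by rw [sub_eq_add_neg]; rfl)
  · refine hσ.ne (i + 1) ?_
    have : i + 1 + 1 = i - 1 := by rw [add_assoc, sub_eq_add_neg]; rfl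
    simpa [this] using heq
  · obtain ⟨-, -, rfl⟩ | ⟨-, -, rfl⟩ := hQ'
    · refine hσ.not_alternating hn₄ (i - 1) ?_
      have : i - 1 + 2 = i + 1 := by ring
      have : i - 1 + 3 = i + 2 := by ring
      simp [*]
    · refine hσ.not_alternating hn₄ (i - 2) ?_
      have : i - 2 + 1 = i - 1 := by ring
      have : i - 2 + 3 = i + 1 := by ring
      simp [*]

theorem mem_range_of_touch (h : IsClosedTrail ends x f) (hn : 2 ≤ n) (hF : DegreeLE ends F 2)
    (hf : ∀ i, f i ∈ F) {e g : E} (he : e ∈ Set.range f) (hg : g ∈ F) (hT : Touch ends e g) :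
    g ∈ Set.range f := by
  obtain ⟨i, rfl⟩ := he
  obtain rfl | rfl | rfl := h.eq_of_touch hn hF hf hg hT <;> exact Set.mem_range_self _

theorem range_subset_range {n' : ℕ} {x' : ZMod n' → V} {f' : ZMod n' → E}
    (h : IsClosedTrail ends x f) (h' : IsClosedTrail ends x' f') (hn : 2 ≤ n) (hn' : 2 ≤ n')
    (hF : DegreeLE ends F 2) (hf : ∀ i, f i ∈ F) (hf' : ∀ i, f' i ∈ F)
    (hT : Touch ends (f 0) (f' 0)) : Set.range f' ⊆ Set.range f := by
  have : NeZero n' := ⟨by lia⟩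
  have mem (k : ℕ) : f' k ∈ Set.range f := by
    induction k with
    | zero => simpa using h.mem_range_of_touch hn hF hf (Set.mem_range_self 0) (hf' 0) hT
    | succ k ih =>
      refine h.mem_range_of_touch hn hF hf ih (hf' _) ⟨x' (k + 1), h'.right_mem k, ?_⟩
      simpa using h'.left_mem (k + 1)
  rintro _ ⟨i, rfl⟩
  simpa using mem i.val

theorem range_eq {n' : ℕ} {x' : ZMod n' → V} {f' : ZMod n' → E} (h : IsClosedTrail ends x f)
    (h' : IsClosedTrail ends x' f') (hn : 2 ≤ n) (hn' : 2 ≤ n') (hF : DegreeLE ends F 2)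
    (hf : ∀ i, f i ∈ F) (hf' : ∀ i, f' i ∈ F) (h₀ : x 0 = x' 0) : Set.range f = Set.range f' :=
  have hT : Touch ends (f 0) (f' 0) := ⟨x 0, h.left_mem 0, h₀ ▸ h'.left_mem 0⟩
  (h'.range_subset_range h hn' hn hF hf' hf hT.symm).antisymm
    (h.range_subset_range h' hn hn' hF hf hf' hT)

theorem isStarOn_extend (h : IsClosedTrail ends x f) (hn : 2 ≤ n) (hF : DegreeLE ends F 2)
    (hf : ∀ i, f i ∈ F) {S : Finset E} (hS : ∀ g, g ∈ S ↔ g ∈ F ∧ g ∉ Set.range f) {σ : E → C}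
    (hσ : IsStarOn ends S σ) {c : ZMod n → C} (hc : IsStarCycleColoring c) :
    IsStarOn ends F (Function.extend f c σ) := by
  classical
  let T := F.filter (· ∈ Set.range f)
  have mem_T {g} : g ∈ T ↔ ∃ i, f i = g := by
    simp only [T, Finset.mem_filter, Set.mem_range, and_iff_right_iff_imp]
    rintro ⟨i, rfl⟩
    exact hf i
  have hT : IsStarOn ends T (Function.extend f c σ) :=
    h.isStarOn hn (hF.mono (Finset.filter_subset _ _)) (fun _ => mem_T)
      (by rwa [Function.extend_comp h.injective])
  have hS' : IsStarOn ends S (Function.extend f c σ) :=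
    hσ.congr fun g hg => (Function.extend_apply' _ _ _ ((hS g).mp hg).2).symm
  have hF' : T ∪ S = F := by
    ext g
    simp only [Finset.mem_union, T, Finset.mem_filter, hS, ← and_or_left, em, and_true]
  rw [← hF']
  refine isStarOn_union hT hS' fun e he g hg hT => ((hS g).mp hg).2 ?_
  exact h.mem_range_of_touch hn hF hf (mem_T.mp he) ((hS g).mp hg).1 hT

end IsClosedTrail

theorem exists_nonbacktracking_walk (hne : F.Nonempty)
    (hF : ∀ e ∈ F, ∀ v ∈ ends e, ∃ g ∈ F, g ≠ e ∧ v ∈ ends g) :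
    ∃ (x : ℕ → V) (f : ℕ → E),
      ∀ i, f i ∈ F ∧ ends (f i) = s(x i, x (i + 1)) ∧ f (i + 1) ≠ f i := by
  let Dart := {p : V × E // p.2 ∈ F ∧ p.1 ∈ ends p.2}
  have exists_next (p : Dart) :
      ∃ q : Dart, ends p.1.2 = s(p.1.1, q.1.1) ∧ q.1.2 ≠ p.1.2 := by
    obtain ⟨⟨v, e⟩, he, hv⟩ := p
    obtain ⟨w, hw⟩ := Sym2.mem_iff_exists.mp hv
    obtain ⟨g, hg, hge, hwg⟩ := hF e he w (by rw [hw]; exact Sym2.mem_mk_right v w)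
    exact ⟨⟨(w, g), hg, hwg⟩, hw, hge⟩
  choose next hlink hnext using exists_next
  obtain ⟨e, he⟩ := hne
  obtain ⟨v, hv, -⟩ := Touch.refl (ends := ends) e
  let p (i : ℕ) : Dart := next^[i] ⟨(v, e), he, hv⟩
  have p_succ (i : ℕ) : p (i + 1) = next (p i) := Function.iterate_succ_apply' _ _ _
  refine ⟨fun i => (p i).1.1, fun i => (p i).1.2, fun i => ⟨(p i).2.1, ?_, ?_⟩⟩
  · simpa only [p_succ] using hlink (p i)
  · simpa only [p_succ] using hnext (p i)

theorem exists_isClosedTrail_of_walk {x : ℕ → V} {f : ℕ → E} {i j : ℕ} (hij : i + 2 ≤ j)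
    (hlink : ∀ k, ends (f k) = s(x k, x (k + 1))) (hne : ∀ k, f (k + 1) ≠ f k)
    (hx : x i = x j) (hinj : ∀ a b, i ≤ a → a < b → b < j → x a ≠ x b) :
    ∃ x' : ZMod (j - i) → V, IsClosedTrail ends x' fun k => f (i + k.val) := by
  have : NeZero (j - i) := ⟨by lia⟩
  have f_ne (a b : ℕ) (ha : i ≤ a) (hab : a < b) (hb : b < j) : f a ≠ f b := fun h => by
    have hends : s(x a, x (a + 1)) = s(x b, x (b + 1)) := by rw [← hlink, ← hlink, h]
    obtain ⟨hx', -⟩ | ⟨-, hx'⟩ := Sym2.eq_iff.mp hends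
    · exact hinj a b ha hab hb hx'
    · obtain hlt | rfl : a + 1 < b ∨ a + 1 = b := by lia
      · exact hinj (a + 1) b (by lia) hlt hb hx'
      · exact hne a h.symm
  refine ⟨fun k => x (i + k.val), fun k => ?_, fun k l h => ZMod.val_injective _ ?_⟩
  · have hk := k.val_lt
    have hval := val_add_natCast (k := 1) (by lia) k
    rw [Nat.cast_one] at hval
    rw [hlink, hval]
    split_ifs with hlt
    · rw [add_assoc]
    · rw [show i + k.val + 1 = j by lia, ← hx, show i + (k.val + 1 - (j - i)) = i by lia]
  · have hk := k.val_lt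
    have hl := l.val_lt
    by_contra hkl
    obtain hlt | hlt := lt_or_gt_of_ne hkl
    · exact f_ne _ _ (by lia) (by lia) (by lia) h
    · exact f_ne _ _ (by lia) (by lia) (by lia) h.symm

theorem exists_isClosedTrail [Finite V] (hloop : ∀ e ∈ F, ¬ (ends e).IsDiag) (hne : F.Nonempty)
    (hF : ∀ e ∈ F, ∀ v ∈ ends e, ∃ g ∈ F, g ≠ e ∧ v ∈ ends g) :
    ∃ n, 2 ≤ n ∧ ∃ (x : ZMod n → V) (f : ZMod n → E), IsClosedTrail ends x f ∧ ∀ i, f i ∈ F := by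
  classical
  obtain ⟨x, f, hwalk⟩ := exists_nonbacktracking_walk hne hF
  have hrepeat : ∃ j, ∃ i < j, x i = x j := by
    obtain ⟨a, b, hab, h⟩ := Finite.exists_ne_map_eq_of_infinite x
    obtain hlt | hlt := lt_or_gt_of_ne hab
    exacts [⟨b, a, hlt, h⟩, ⟨a, b, hlt, h.symm⟩]
  obtain ⟨i, hij, hx⟩ := Nat.find_spec hrepeat
  have hmin (a b : ℕ) (hab : a < b) (hb : b < Nat.find hrepeat) : x a ≠ x b :=
    fun h => Nat.find_min hrepeat hb ⟨a, hab, h⟩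
  have hne_succ : x i ≠ x (i + 1) := fun h =>
    hloop _ (hwalk i).1 (by rw [(hwalk i).2.1, Sym2.mk_isDiag_iff]; exact h)
  have hlen : i + 2 ≤ Nat.find hrepeat := by
    have : Nat.find hrepeat ≠ i + 1 := fun h => hne_succ (by rw [← h]; exact hx)
    lia
  obtain ⟨x', hx'⟩ := exists_isClosedTrail_of_walk hlen (fun k => (hwalk k).2.1)
    (fun k => (hwalk k).2.2) hx fun a b _ => hmin a b
  exact ⟨_, by lia, x', _, hx', fun k => (hwalk _).1⟩

theorem exists_isStarOn_of_degreeLE_two [Finite V] [Nonempty (E → C)]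
    (hloop : ∀ e ∈ F, ¬ (ends e).IsDiag) (hF : DegreeLE ends F 2) {R : E → Finset C}
    (hR : ∀ e ∈ F, 3 ≤ #(R e))
    (h₅ : ∀ (x : ZMod 5 → V) (f : ZMod 5 → E), IsClosedTrail ends x f → (∀ i, f i ∈ F) →
      ¬ ∃ A, #A = 3 ∧ ∀ i, R (f i) = A) :
    ∃ σ : E → C, IsStarOn ends F σ ∧ ∀ e ∈ F, σ e ∈ R e := by
  classical
  induction F using Finset.strongInduction with
  | H F ih =>
  have ih' (S) (hS : S ⊂ F) := ih S hS (fun e he => hloop e (hS.subset he)) (hF.mono hS.subset)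
    (fun e he => hR e (hS.subset he)) fun x f h hf => h₅ x f h fun i => hS.subset (hf i)
  obtain rfl | hne := F.eq_empty_or_nonempty
  · exact ⟨Classical.arbitrary _, ⟨by simp, by simp⟩, by simp⟩
  by_cases hleaf : ∀ e ∈ F, ∀ v ∈ ends e, ∃ g ∈ F, g ≠ e ∧ v ∈ ends g
  · obtain ⟨n, hn, x, f, hx, hf⟩ := exists_isClosedTrail hloop hne hleaf
    let S := F.filter (· ∉ Set.range f)
    have hS : S ⊂ F := Finset.filter_ssubset.mpr ⟨f 0, hf 0, not_not.mpr (Set.mem_range_self 0)⟩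
    obtain ⟨σ, hσ, hσR⟩ := ih' S hS
    obtain ⟨c, hc, hcR⟩ := exists_isStarCycleColoring hn (R := fun i => R (f i))
      (fun i => hR _ (hf i)) (by rintro rfl; exact h₅ x f hx hf)
    refine ⟨_, hx.isStarOn_extend hn hF hf (by simp [S]) hσ hc, fun g hg => ?_⟩
    by_cases hgf : g ∈ Set.range f
    · obtain ⟨i, rfl⟩ := hgf
      simpa only [hx.injective.extend_apply] using hcR i
    · rw [Function.extend_apply' _ _ _ hgf]
      exact hσR g (Finset.mem_filter.mpr ⟨hg, hgf⟩)
  · push Not at hleaf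
    obtain ⟨e, he, u, hu, hleaf⟩ := hleaf
    obtain ⟨σ, hσ, hσR⟩ := ih' _ (Finset.erase_ssubset he)
    have hnear : #(near ends F F e) ≤ 1 * 2 := card_near_le_of_leaf subset_rfl he hF hF hu
      fun g hg hug => by_contra fun h => hleaf g hg h hug
    obtain ⟨z, hz, hstar⟩ := hσ.exists_update (hnear.trans_lt (hR e he))
    refine ⟨_, hstar, fun g hg => ?_⟩
    obtain rfl | hge := eq_or_ne g e
    · rwa [Function.update_self]
    · rw [Function.update_of_ne hge]
      exact hσR g (Finset.mem_erase.mpr ⟨hge, hg⟩)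

end ClosedTrail

/-! ### Coloring a matching first -/

section Matching

open Classical in
/-- The colors of the list of `e` that remain available once the edges of `M` are colored by `σ`,
when no edge of `M` at distance at most two from `e` may share its color. -/
noncomputable def freeColors (ends : E → Sym2 V) (D M : Finset E) (L : E → Finset C) (σ : E → C)
    (e : E) : Finset C :=
  L e \ (near ends D M e).image σ

variable {ends : E → Sym2 V} {D M F P T : Finset E} {L : E → Finset C} {σ τ : E → C}
  {x x' : ZMod 5 → V} {f f' : ZMod 5 → E} {e m : E} {z z' : C}

theorem card_le_card_freeColors_add (e : E) :
    #(L e) ≤ #(freeColors ends D M L σ e) + #(near ends D M e) := by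
  classical
  have := Finset.le_card_sdiff ((near ends D M e).image σ) (L e)
  have := Finset.card_image_le (s := near ends D M e) (f := σ)
  unfold freeColors
  lia

theorem freeColors_subset (e : E) : freeColors ends D M L σ e ⊆ L e := by
  classical
  exact Finset.sdiff_subset

theorem freeColors_congr (h : ∀ m ∈ near ends D M e, σ m = τ m) :
    freeColors ends D M L σ e = freeColors ends D M L τ e := by
  classical
  rw [freeColors, freeColors, Finset.image_congr h]

theorem notMem_freeColors (h : m ∈ near ends D M e) : σ m ∉ freeColors ends D M L σ e := by
  classical
  exact fun hm => (Finset.mem_sdiff.mp hm).2 (Finset.mem_image_of_mem σ h)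

variable [DecidableEq E]

/-- The subgraph with edge set `M ∪ F` is split into a matching `M` and a rest `F` of maximum degree
at most two. -/
structure IsSplitting (ends : E → Sym2 V) (M F : Finset E) : Prop where
  degreeLE_one : DegreeLE ends M 1
  degreeLE_two : DegreeLE ends F 2
  disjoint : Disjoint M F

/-- The closed trail given by `x` and `f` is a cycle of length five in `F` whose edges all have the
same three colors left, so that the coloring `σ` of `M` does not extend to it. -/
structure IsObstruction (ends : E → Sym2 V) (M F : Finset E) (L : E → Finset C) (σ : E → C)
    (x : ZMod 5 → V) (f : ZMod 5 → E) : Prop where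
  isClosedTrail : IsClosedTrail ends x f
  mem : ∀ i, f i ∈ F
  exists_eq : ∃ A, #A = 3 ∧ ∀ i, freeColors ends (M ∪ F) M L σ (f i) = A

/-- The coloring `σ` of `T ⊆ M` separates the edges of `T` at distance at most two, and does not
create an obstruction on any cycle all of whose vertices are ends of edges in `T`. -/
structure IsAdmissible (ends : E → Sym2 V) (M F : Finset E) (L : E → Finset C) (T : Finset E)
    (σ : E → C) : Prop where
  separated : ∀ m ∈ T, ∀ m' ∈ near ends (M ∪ F) T m, σ m' ≠ σ m
  not_isObstruction : ∀ x f, (∀ i, ∃ m ∈ T, x i ∈ ends m) → ¬ IsObstruction ends M F L σ x f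

theorem mem_freeColors_update (hm : m ∈ near ends D M e)
    (hz : #(near ends D M e) + #(freeColors ends D M L (Function.update σ m z) e) ≤ #(L e))
    (hne : z ≠ z') : z ∈ freeColors ends D M L (Function.update σ m z') e := by
  classical
  by_contra hmem
  have hsub : L e \ ((near ends D M e).erase m).image σ ⊆
      freeColors ends D M L (Function.update σ m z) e := fun c hc => by
    simp only [freeColors, Finset.mem_sdiff, Finset.mem_image, Finset.mem_erase, not_exists,
      not_and, Function.update_apply] at hc hmem ⊢
    grind
  have := (Finset.le_card_sdiff _ _).trans (Finset.card_le_card hsub)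
  have := Finset.card_image_le (s := (near ends D M e).erase m) (f := σ)
  have := Finset.card_erase_lt_of_mem hm
  lia

namespace IsSplitting

theorem degreeLE_three (h : IsSplitting ends M F) : DegreeLE ends (M ∪ F) 3 := fun x => by
  have hx : edgesAt ends (M ∪ F) x ⊆ edgesAt ends M x ∪ edgesAt ends F x := fun e he => by
    simpa only [Finset.mem_union, mem_edgesAt, or_and_right] using he
  have := (Finset.card_le_card hx).trans (Finset.card_union_le _ _)
  have := h.degreeLE_one x
  have := h.degreeLE_two x
  lia

theorem card_near_le (h : IsSplitting ends M F) (he : e ∈ M ∪ F) :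
    #(near ends (M ∪ F) M e) ≤ 4 :=
  StarEdgeColoring.card_near_le (k := 2) (s := 1) Finset.subset_union_left he h.degreeLE_three
    h.degreeLE_one

theorem exists_mem_edgesAt_of_mem_near (h : IsSplitting ends M F) (hx : IsClosedTrail ends x f)
    (hf : ∀ i, f i ∈ F) {i : ZMod 5} (hm : m ∈ near ends (M ∪ F) M (f i)) :
    ∃ j, j ≠ i + 3 ∧ m ∈ edgesAt ends M (x j) := by
  obtain ⟨hmM, -, g, hg, hig, y, hyg, hym⟩ := mem_near.mp hm
  obtain ⟨k, hk, hkg⟩ : ∃ k, (k = i - 1 ∨ k = i ∨ k = i + 1) ∧ Touch ends (f k) m := by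
    obtain hgM | hgF := Finset.mem_union.mp hg
    · exact ⟨i, .inr (.inl rfl), h.degreeLE_one.eq_of_mem hgM hmM hyg hym ▸ hig⟩
    · obtain rfl | rfl | rfl := hx.eq_of_touch (by lia) h.degreeLE_two hf hgF hig
      exacts [⟨_, .inl rfl, y, hyg, hym⟩, ⟨_, .inr (.inl rfl), y, hyg, hym⟩,
        ⟨_, .inr (.inr rfl), y, hyg, hym⟩]
  obtain ⟨w, hw, hwm⟩ := hkg
  have hne : k ≠ i + 3 ∧ k + 1 ≠ i + 3 := by
    clear * - hk
    decide +revert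
  rw [hx.link, Sym2.mem_iff] at hw
  obtain rfl | rfl := hw
  exacts [⟨k, hne.1, mem_edgesAt.mpr ⟨hmM, hwm⟩⟩, ⟨k + 1, hne.2, mem_edgesAt.mpr ⟨hmM, hwm⟩⟩]

end IsSplitting

namespace IsObstruction

theorem not_edgesAt_subset (h : IsObstruction ends M F L σ x f) (hMF : IsSplitting ends M F)
    (hL : ∀ e ∈ F, 7 ≤ #(L e)) {j k : ZMod 5} (hjk : j ≠ k) :
    ¬ edgesAt ends M (x j) ⊆ edgesAt ends M (x k) := fun hsub => by
  obtain ⟨A, hA, hfree⟩ := h.exists_eq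
  obtain ⟨i, hij, hik⟩ : ∃ i : ZMod 5, j ≠ i + 3 ∧ k ≠ i + 3 := by
    clear * -
    decide +revert
  have hnear : near ends (M ∪ F) M (f i) ⊆
      (Finset.univ \ {i + 3, j}).biUnion fun l => edgesAt ends M (x l) := fun m hm => by
    obtain ⟨l, hl, hml⟩ := hMF.exists_mem_edgesAt_of_mem_near h.isClosedTrail h.mem hm
    simp only [Finset.mem_biUnion, Finset.mem_sdiff, Finset.mem_univ, true_and,
      Finset.mem_insert, Finset.mem_singleton, not_or]
    obtain rfl | hlj := eq_or_ne l j
    · exact ⟨k, ⟨hik, hjk.symm⟩, hsub hml⟩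
    · exact ⟨l, ⟨hl, hlj⟩, hml⟩
  have hcard : #(Finset.univ \ {i + 3, j} : Finset (ZMod 5)) = 3 := by
    rw [Finset.card_sdiff_of_subset (Finset.subset_univ _), Finset.card_pair hij.symm]
    rfl
  have hnear₃ := (Finset.card_le_card hnear).trans
    (Finset.card_biUnion_le_card_mul _ _ 1 fun l _ => hMF.degreeLE_one _)
  have hle := card_le_card_freeColors_add (ends := ends) (D := M ∪ F) (M := M) (L := L) (σ := σ)
    (f i)
  have := hL _ (h.mem i)
  rw [hfree, hA] at hle
  lia

theorem rotate (h : IsObstruction ends M F L σ x f) (i : ZMod 5) :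
    IsObstruction ends M F L σ (fun j => x (j + i)) fun j => f (j + i) where
  isClosedTrail :=
    { link := fun j => by rw [h.isClosedTrail.link, add_right_comm]
      injective := h.isClosedTrail.injective.comp (add_left_injective i) }
  mem _ := h.mem _
  exists_eq := h.exists_eq.imp fun _ hA => ⟨hA.1, fun _ => hA.2 _⟩

theorem notMem_near (h : IsObstruction ends M F L σ x f) (hMF : IsSplitting ends M F)
    (hL : ∀ e ∈ F, 7 ≤ #(L e)) (hm : m ∈ edgesAt ends M (x 0)) :
    m ∉ near ends (M ∪ F) M (f 2) := fun hmem => by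
  obtain ⟨j, hj, hmj⟩ := hMF.exists_mem_edgesAt_of_mem_near h.isClosedTrail h.mem hmem
  refine h.not_edgesAt_subset hMF hL (show j ≠ 0 from hj) fun g hg => ?_
  rwa [Finset.card_le_one.mp (hMF.degreeLE_one _) g hg m hmj]

theorem eq_of_update (h : IsObstruction ends M F L (Function.update σ m z) x f)
    (h' : IsObstruction ends M F L (Function.update σ m z') x' f') (hMF : IsSplitting ends M F)
    (hL : ∀ e ∈ F, 7 ≤ #(L e)) (hm : m ∈ edgesAt ends M (x 0)) (hx : x 0 = x' 0) : z = z' := by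
  obtain ⟨A, hA, hfree⟩ := h.exists_eq
  obtain ⟨A', -, hfree'⟩ := h'.exists_eq
  replace hfree' (i) : freeColors ends (M ∪ F) M L (Function.update σ m z') (f i) = A' := by
    have hrange := h.isClosedTrail.range_eq h'.isClosedTrail (by lia) (by lia)
      hMF.degreeLE_two h.mem h'.mem hx
    obtain ⟨j, hj⟩ := hrange ▸ Set.mem_range_self i
    rw [← hj, hfree']
  have hAA' : A = A' := by
    rw [← hfree 2, ← hfree' 2]
    refine freeColors_congr fun g hg => ?_
    have hgm : g ≠ m := ne_of_mem_of_not_mem hg (h.notMem_near hMF hL hm)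
    rw [Function.update_of_ne hgm, Function.update_of_ne hgm]
  have hnear : m ∈ near ends (M ∪ F) M (f 0) := mem_near.mpr
    ⟨(mem_edgesAt.mp hm).1,
      fun he => Finset.disjoint_left.mp hMF.disjoint (mem_edgesAt.mp hm).1 (he ▸ h.mem 0),
      f 0, Finset.mem_union_right _ (h.mem 0), .refl _,
      x 0, h.isClosedTrail.left_mem 0, (mem_edgesAt.mp hm).2⟩
  by_contra hne
  have hz : z ∈ A := by
    rw [hAA', ← hfree' 0]
    refine mem_freeColors_update hnear ?_ hne
    have := hL _ (h.mem 0)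
    have := hMF.card_near_le (Finset.mem_union_right M (h.mem 0))
    rw [hfree, hA]
    lia
  rw [← hfree 0] at hz
  exact notMem_freeColors (σ := Function.update σ m z) hnear (by rwa [Function.update_self])

end IsObstruction

theorem IsSplitting.exists_subsingleton_of_isObstruction (h : IsSplitting ends M F)
    (hL : ∀ e ∈ F, 7 ≤ #(L e)) (hm : m ∈ M) {v : V} (hv : v ∈ ends m) :
    ∃ B : Finset C, #B ≤ 1 ∧ ∀ z x f, IsObstruction ends M F L (Function.update σ m z) x f →
      v ∈ Set.range x → z ∈ B := by
  classical
  by_cases hex : ∃ z x f, IsObstruction ends M F L (Function.update σ m z) x f ∧ x 0 = v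
  · obtain ⟨z, x, f, hxf, rfl⟩ := hex
    refine ⟨{z}, by simp, fun z' x' f' hxf' ⟨i, hi⟩ => ?_⟩
    rw [Finset.mem_singleton]
    exact ((hxf.eq_of_update (hxf'.rotate i) h hL (mem_edgesAt.mpr ⟨hm, hv⟩)) (by simp [hi])).symm
  · exact ⟨∅, by simp, fun z x f hxf ⟨i, hi⟩ =>
      (hex ⟨z, _, _, hxf.rotate i, by simpa using hi⟩).elim⟩

theorem IsObstruction.of_update (h : IsObstruction ends M F L (Function.update σ m z) x f)
    (hMF : IsSplitting ends M F) (hm : ∀ i, x i ∉ ends m) : IsObstruction ends M F L σ x f where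
  isClosedTrail := h.isClosedTrail
  mem := h.mem
  exists_eq := h.exists_eq.imp fun A hA => ⟨hA.1, fun i => by
    rw [← hA.2 i]
    refine freeColors_congr fun g hg => (Function.update_of_ne ?_ z σ).symm
    rintro rfl
    obtain ⟨j, -, hj⟩ := hMF.exists_mem_edgesAt_of_mem_near h.isClosedTrail h.mem hg
    exact hm j (mem_edgesAt.mp hj).2⟩

theorem ne_of_mem_near_insert (hσ : ∀ e ∈ T, ∀ e' ∈ near ends D T e, σ e' ≠ σ e)
    (hz : ∀ e ∈ T, e ∈ near ends D T m → σ e ≠ z) :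
    ∀ e ∈ insert m T, ∀ e' ∈ near ends D (insert m T) e,
      Function.update σ m z e' ≠ Function.update σ m z e := fun e he e' he' => by
  have hne := (mem_near.mp he').2.1
  have mem_T {g} (hg : g ∈ insert m T) (hgm : g ≠ m) : g ∈ T :=
    (Finset.mem_insert.mp hg).resolve_left hgm
  have near_T {g} (hg : g ∈ near ends D (insert m T) e) (hgm : g ≠ m) : g ∈ near ends D T e :=
    mem_near.mpr ⟨mem_T (mem_near.mp hg).1 hgm, (mem_near.mp hg).2⟩
  obtain rfl | hem := eq_or_ne e m
  · rw [Function.update_self, Function.update_of_ne hne]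
    exact hz e' (mem_T (mem_near.mp he').1 hne) (near_T he' hne)
  rw [Function.update_of_ne hem]
  obtain rfl | hem' := eq_or_ne e' m
  · rw [Function.update_self]
    exact (hz e (mem_T he hem) ((near_comm (mem_T he hem) (mem_near.mp he').1).mp he')).symm
  · rw [Function.update_of_ne hem']
    exact hσ e (mem_T he hem) e' (near_T he' hem')

theorem IsAdmissible.exists_update (hσ : IsAdmissible ends M F L T σ) (h : IsSplitting ends M F)
    (hL : ∀ e ∈ F, 7 ≤ #(L e)) (hT : T ⊆ M) (hm : m ∈ M) (hLm : 7 ≤ #(L m)) :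
    ∃ z ∈ L m, IsAdmissible ends M F L (insert m T) (Function.update σ m z) := by
  classical
  obtain ⟨u, w, huw⟩ : ∃ u w, ends m = s(u, w) := (ends m).ind fun u w => ⟨u, w, rfl⟩
  obtain ⟨B, hB, hBu⟩ :=
    h.exists_subsingleton_of_isObstruction (σ := σ) hL hm (v := u) (by simp [huw])
  obtain ⟨B', hB', hBw⟩ :=
    h.exists_subsingleton_of_isObstruction (σ := σ) hL hm (v := w) (by simp [huw])
  have hcard : #((near ends (M ∪ F) M m).image σ ∪ (B ∪ B')) < #(L m) := by
    have := Finset.card_union_le ((near ends (M ∪ F) M m).image σ) (B ∪ B')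
    have := Finset.card_image_le (s := near ends (M ∪ F) M m) (f := σ)
    have := Finset.card_union_le B B'
    have := h.card_near_le (Finset.mem_union_left F hm)
    lia
  obtain ⟨z, hz, hz'⟩ := Finset.exists_mem_notMem_of_card_lt_card hcard
  simp only [Finset.mem_union, not_or] at hz'
  obtain ⟨hzσ, hzB, hzB'⟩ := hz'
  refine ⟨z, hz, ?_, fun x f hcov hxf => ?_⟩
  · refine ne_of_mem_near_insert hσ.separated fun e _ he heq => hzσ ?_
    exact heq ▸ Finset.mem_image_of_mem σ (near_mono subset_rfl hT he)
  · by_cases hx : ∃ i, x i ∈ ends m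
    · obtain ⟨i, hi⟩ := hx
      rw [huw, Sym2.mem_iff] at hi
      obtain hi | hi := hi
      exacts [hzB (hBu z x f hxf ⟨i, hi⟩), hzB' (hBw z x f hxf ⟨i, hi⟩)]
    · push Not at hx
      refine hσ.not_isObstruction x f (fun i => ?_) (hxf.of_update h hx)
      obtain ⟨g, hg, hxg⟩ := hcov i
      exact ⟨g, (Finset.mem_insert.mp hg).resolve_left fun hgm => hx i (hgm ▸ hxg), hxg⟩

theorem isAdmissible_of_card_le_one (hT : #T ≤ 1) (h : IsSplitting ends M F) (hTM : T ⊆ M)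
    (hL : ∀ e ∈ F, 7 ≤ #(L e)) : IsAdmissible ends M F L T σ where
  separated m hm m' hm' :=
    ((mem_near.mp hm').2.1 (Finset.card_le_one.mp hT _ (mem_near.mp hm').1 _ hm)).elim
  not_isObstruction x f hcov hxf := by
    obtain ⟨m, hm, h₀⟩ := hcov 0
    obtain ⟨m', hm', h₁⟩ := hcov 1
    obtain rfl := Finset.card_le_one.mp hT _ hm _ hm'
    refine hxf.not_edgesAt_subset h hL (show (0 : ZMod 5) ≠ 1 by decide) fun g hg => ?_
    rw [Finset.card_le_one.mp (h.degreeLE_one _) g hg m (mem_edgesAt.mpr ⟨hTM hm, h₀⟩)]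
    exact mem_edgesAt.mpr ⟨hTM hm, h₁⟩

theorem IsAdmissible.exists_extension (hσ : IsAdmissible ends M F L P σ) (h : IsSplitting ends M F)
    (hL : ∀ e ∈ F, 7 ≤ #(L e)) (hP : P ⊆ M) (hLM : ∀ e ∈ M, e ∉ P → 7 ≤ #(L e)) :
    ∃ τ, IsAdmissible ends M F L M τ ∧ (∀ e ∈ P, τ e = σ e) ∧ ∀ e ∈ M, e ∉ P → τ e ∈ L e := by
  suffices ∀ Q ⊆ M \ P, ∃ τ, IsAdmissible ends M F L (P ∪ Q) τ ∧ (∀ e ∈ P, τ e = σ e) ∧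
      ∀ e ∈ Q, τ e ∈ L e by
    obtain ⟨τ, hτ, hτP, hτL⟩ := this _ subset_rfl
    rw [Finset.union_sdiff_of_subset hP] at hτ
    exact ⟨τ, hτ, hτP, fun e he heP => hτL e (Finset.mem_sdiff.mpr ⟨he, heP⟩)⟩
  intro Q hQ
  induction Q using Finset.induction_on with
  | empty => exact ⟨σ, by simpa using hσ, by simp, by simp⟩
  | insert m Q hmQ ih =>
    rw [Finset.insert_subset_iff, Finset.mem_sdiff] at hQ
    obtain ⟨⟨hmM, hmP⟩, hQ⟩ := hQ
    obtain ⟨τ, hτ, hτP, hτL⟩ := ih hQ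
    obtain ⟨z, hz, hzτ⟩ := hτ.exists_update h hL
      (Finset.union_subset hP (hQ.trans Finset.sdiff_subset)) hmM (hLM m hmM hmP)
    refine ⟨_, by rwa [Finset.union_insert], fun e he => ?_, fun e he => ?_⟩
    · rw [Function.update_of_ne (ne_of_mem_of_not_mem he hmP), hτP e he]
    · obtain rfl | hem := eq_or_ne e m
      · rwa [Function.update_self]
      · rw [Function.update_of_ne hem]
        exact hτL e ((Finset.mem_insert.mp he).resolve_left hem)

theorem IsAdmissible.not_isObstruction_of_isSplitting (hσ : IsAdmissible ends M F L M σ)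
    (h : IsSplitting ends M F) (hL : ∀ e ∈ F, 7 ≤ #(L e)) : ¬ IsObstruction ends M F L σ x f :=
  fun hxf => hσ.not_isObstruction x f (fun i => by
    by_contra! hi
    refine hxf.not_edgesAt_subset h hL ((by decide : ∀ i : ZMod 5, i ≠ i + 1) i) fun g hg => ?_
    exact (hi g (mem_edgesAt.mp hg).1 (mem_edgesAt.mp hg).2).elim) hxf

theorem IsAdmissible.isStrongAt (hσ : IsAdmissible ends M F L M σ) (hτM : ∀ e ∈ M, τ e = σ e)
    (hτF : ∀ e ∈ F, τ e ∈ freeColors ends (M ∪ F) M L σ e) (hm : m ∈ M) :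
    IsStrongAt ends (M ∪ F) τ m := fun e he => by
  rw [hτM m hm]
  by_cases heM : e ∈ M
  · rw [hτM e heM]
    exact hσ.separated m hm e (mem_near.mpr ⟨heM, (mem_near.mp he).2⟩)
  · have heF := (Finset.mem_union.mp (mem_near.mp he).1).resolve_left heM
    exact ne_of_mem_of_not_mem (hτF e heF)
      (notMem_freeColors ((near_comm (Finset.mem_union_right _ heF) hm).mpr he))

theorem IsSplitting.exists_isStarOn [Finite V] (h : IsSplitting ends M F)
    (hloop : ∀ e ∈ F, ¬ (ends e).IsDiag) (hL : ∀ e ∈ F, 7 ≤ #(L e)) (hP : P ⊆ M) (hP₁ : #P ≤ 1)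
    (hLM : ∀ e ∈ M, e ∉ P → 7 ≤ #(L e)) (σ : E → C) :
    ∃ τ, IsStarOn ends (M ∪ F) τ ∧ (∀ m ∈ M, IsStrongAt ends (M ∪ F) τ m) ∧
      (∀ e ∈ P, τ e = σ e) ∧ ∀ e ∈ M ∪ F, e ∉ P → τ e ∈ L e := by
  obtain ⟨τ, hτ, hτP, hτL⟩ :=
    (isAdmissible_of_card_le_one (σ := σ) hP₁ h hP hL).exists_extension h hL hP hLM
  have hfree : ∀ e ∈ F, 3 ≤ #(freeColors ends (M ∪ F) M L τ e) := fun e he => by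
    have := hL e he
    have := card_le_card_freeColors_add (ends := ends) (D := M ∪ F) (M := M) (L := L) (σ := τ) e
    have := h.card_near_le (Finset.mem_union_right M he)
    lia
  have : Nonempty (E → C) := ⟨σ⟩
  obtain ⟨ρ, hρ, hρfree⟩ := exists_isStarOn_of_degreeLE_two hloop h.degreeLE_two hfree
    fun x f hx hf hA => hτ.not_isObstruction_of_isSplitting h hL ⟨hx, hf, hA⟩
  let κ := M.piecewise τ ρ
  have κ_M (e) (he : e ∈ M) : κ e = τ e := Finset.piecewise_eq_of_mem _ _ _ he
  have κ_F (e) (he : e ∈ F) : κ e = ρ e :=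
    Finset.piecewise_eq_of_notMem _ _ _ (Finset.disjoint_right.mp h.disjoint he)
  have hstrong (m) (hm : m ∈ M) : IsStrongAt ends (M ∪ F) κ m :=
    hτ.isStrongAt κ_M (fun e he => κ_F e he ▸ hρfree e he) hm
  refine ⟨κ, isStarOn_of_isStrongAt hstrong ?_, hstrong, fun e he => ?_, fun e he heP => ?_⟩
  · rw [Finset.union_sdiff_cancel_left h.disjoint]
    exact hρ.congr fun e he => (κ_F e he).symm
  · rw [κ_M e (hP he), hτP e he]
  · obtain heM | heF := Finset.mem_union.mp he
    · rw [κ_M e heM]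
      exact hτL e heM heP
    · rw [κ_F e heF]
      exact freeColors_subset e (hρfree e heF)

end Matching

/-! ### Tutte's condition for a matching covering a given set of vertices -/

section Tutte

variable {W : Type*}

/-- A family of odd vertex sets as it appears in Tutte's condition for `G` and `u`: disjoint unions
of components of `G - u`. -/
structure IsOddFamily (G : SimpleGraph W) (u : Finset W) (𝒵 : Finset (Finset W)) : Prop where
  odd : ∀ Z ∈ 𝒵, Odd #Z
  disjoint : ∀ Z ∈ 𝒵, Disjoint Z u
  pairwiseDisjoint : (𝒵 : Set (Finset W)).PairwiseDisjoint id
  mem_or_mem : ∀ Z ∈ 𝒵, ∀ a ∈ Z, ∀ b, G.Adj a b → b ∈ Z ∨ b ∈ u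

theorem IsOddFamily.mono {G : SimpleGraph W} {u : Finset W} {𝒵 𝒵' : Finset (Finset W)}
    (h : IsOddFamily G u 𝒵) (hsub : 𝒵' ⊆ 𝒵) : IsOddFamily G u 𝒵' where
  odd Z hZ := h.odd Z (hsub hZ)
  disjoint Z hZ := h.disjoint Z (hsub hZ)
  pairwiseDisjoint := h.pairwiseDisjoint.subset (Finset.coe_subset.mpr hsub)
  mem_or_mem Z hZ := h.mem_or_mem Z (hsub hZ)

theorem exists_isOddFamily_oddComponents [Finite W] (G : SimpleGraph W)
    (u : Finset W) :
    ∃ 𝒵, IsOddFamily G u 𝒵 ∧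
      #𝒵 = ((⊤ : G.Subgraph).deleteVerts (u : Set W)).coe.oddComponents.ncard := by
  classical
  have := Fintype.ofFinite W
  let K := ((⊤ : G.Subgraph).deleteVerts (u : Set W)).coe
  let Z (c : K.ConnectedComponent) : Finset W := c.supp.toFinset.map (.subtype _)
  have mem_Z {c a} : a ∈ Z c ↔ ∃ h, (⟨a, h⟩ : {a // a ∈ _}) ∈ c.supp := by simp [Z]
  have Z_disjoint {c c' a} (ha : a ∈ Z c) (ha' : a ∈ Z c') : c = c' := by
    obtain ⟨h, hc⟩ := mem_Z.mp ha
    obtain ⟨_, hc'⟩ := mem_Z.mp ha'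
    exact hc.symm.trans hc'
  have Z_odd {c} (hc : c ∈ K.oddComponents) : Odd #(Z c) := by
    rw [Finset.card_map, ← Set.ncard_eq_toFinset_card']
    exact hc
  have memO {c} : c ∈ K.oddComponents.toFinset ↔ c ∈ K.oddComponents := Set.mem_toFinset
  refine ⟨K.oddComponents.toFinset.image Z, ⟨?_, ?_, ?_, ?_⟩, ?_⟩
  · simpa only [Finset.forall_mem_image, memO] using fun c hc => Z_odd hc
  · simp only [Finset.forall_mem_image, Finset.disjoint_left]
    intro c _ a ha hau
    obtain ⟨h, -⟩ := mem_Z.mp ha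
    exact h.2 hau
  · simp only [Finset.coe_image, Set.PairwiseDisjoint, Set.Pairwise, Set.forall_mem_image]
    intro c _ c' _ hne
    exact Finset.disjoint_left.mpr fun a ha ha' => hne (congrArg Z (Z_disjoint ha ha'))
  · simp only [Finset.forall_mem_image]
    intro c _ a ha b hab
    refine or_iff_not_imp_right.mpr fun hb => ?_
    obtain ⟨h, hc⟩ := mem_Z.mp ha
    have hK : K.Adj ⟨a, h⟩ ⟨b, trivial, hb⟩ := by simpa [K, hb] using ⟨h.2, hab⟩
    exact mem_Z.mpr ⟨_, (c.mem_supp_congr_adj hK).mp hc⟩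
  · rw [Finset.card_image_of_injOn, Set.ncard_eq_toFinset_card']
    intro c hc c' _ heq
    obtain ⟨a, ha⟩ := Finset.card_pos.mp (Z_odd (memO.mp hc)).pos
    exact Z_disjoint ha (heq ▸ ha)

theorem exists_isPerfectMatching_of_isOddFamily [Fintype W] [DecidableEq W] (G : SimpleGraph W)
    (h : ∀ u 𝒵, IsOddFamily G u 𝒵 → (Odd #𝒵 ↔ Odd #uᶜ) → #𝒵 ≤ #u) :
    ∃ N : G.Subgraph, N.IsPerfectMatching := by
  rw [SimpleGraph.tutte]
  intro u hu
  obtain ⟨u, rfl⟩ := u.toFinite.exists_finset_coe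
  obtain ⟨𝒵, h𝒵, hcard⟩ := exists_isOddFamily_oddComponents G u
  refine (h u 𝒵 h𝒵 ?_).not_gt ?_
  · rw [hcard, SimpleGraph.odd_ncard_oddComponents]
    have hverts : ((⊤ : G.Subgraph).deleteVerts (u : Set W)).verts = ((uᶜ : Finset W) : Set W) := by
      ext
      simp
    rw [hverts, Nat.card_coe_set_eq, Set.ncard_coe_finset]
  · rwa [SimpleGraph.IsTutteViolator, ← hcard, Set.ncard_coe_finset] at hu

/-- The graph on two copies of `W` obtained from `G` by joining all pairs of vertices outside the
first copy of `T`. It has a perfect matching whenever `G` has a matching covering `T`, since it has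
an even number of vertices. -/
def paddedGraph (G : SimpleGraph W) (T : Finset W) : SimpleGraph (W ⊕ W) :=
  G.map Function.Embedding.inl ⊔
    SimpleGraph.fromRel fun p q => p ∉ T.disjSum ∅ ∧ q ∉ T.disjSum ∅

variable {G : SimpleGraph W} {T : Finset W} {u : Finset (W ⊕ W)} {𝒵 : Finset (Finset (W ⊕ W))}

theorem IsOddFamily.eq_of_not_subset (h : IsOddFamily (paddedGraph G T) u 𝒵)
    {Z Z' : Finset (W ⊕ W)} (hZ : Z ∈ 𝒵) (hZ' : Z' ∈ 𝒵) (hZT : ¬ Z ⊆ T.disjSum ∅)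
    (hZT' : ¬ Z' ⊆ T.disjSum ∅) : Z = Z' := by
  obtain ⟨p, hp, hpT⟩ := Finset.not_subset.mp hZT
  obtain ⟨q, hq, hqT⟩ := Finset.not_subset.mp hZT'
  refine h.pairwiseDisjoint.elim hZ hZ' (Finset.not_disjoint_iff.mpr ⟨q, ?_, hq⟩)
  obtain rfl | hpq := eq_or_ne p q
  · exact hp
  · have hqu : q ∉ u := Finset.disjoint_left.mp (h.disjoint Z' hZ') hq
    refine (h.mem_or_mem Z hZ p hp q (.inr ?_)).resolve_right hqu
    exact ((SimpleGraph.fromRel_adj _ p q).mpr ⟨hpq, .inl ⟨hpT, hqT⟩⟩)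

theorem IsOddFamily.exists_toLeft (h : IsOddFamily (paddedGraph G T) u 𝒵)
    (h𝒵 : ∀ Z ∈ 𝒵, Z ⊆ T.disjSum ∅) :
    ∃ 𝒴, IsOddFamily G u.toLeft 𝒴 ∧ (∀ Z ∈ 𝒴, Z ⊆ T) ∧ #𝒴 = #𝒵 := by
  classical
  have eq_disjSum {Z} (hZ : Z ∈ 𝒵) : Z = Z.toLeft.disjSum ∅ :=
    Finset.eq_disjSum_iff.mpr
      ⟨rfl, Finset.subset_empty.mp (Finset.subset_disjSum.mp (h𝒵 Z hZ)).2⟩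
  have inj : Set.InjOn Finset.toLeft (𝒵 : Set (Finset (W ⊕ W))) := fun Z hZ Z' hZ' heq => by
    rw [eq_disjSum hZ, eq_disjSum hZ', heq]
  refine ⟨𝒵.image Finset.toLeft, ⟨?_, ?_, ?_, ?_⟩, ?_, Finset.card_image_of_injOn inj⟩
  · simp only [Finset.forall_mem_image]
    intro Z hZ
    have := h.odd Z hZ
    rwa [eq_disjSum hZ, Finset.card_disjSum, Finset.card_empty, add_zero] at this
  · simp only [Finset.forall_mem_image, Finset.disjoint_left, Finset.mem_toLeft]
    exact fun Z hZ a ha => Finset.disjoint_left.mp (h.disjoint Z hZ) ha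
  · rw [Finset.coe_image, inj.pairwiseDisjoint_image]
    intro Z hZ Z' hZ' hne
    simp only [Function.comp, id, Finset.disjoint_left, Finset.mem_toLeft]
    exact fun a ha => Finset.disjoint_left.mp (h.pairwiseDisjoint hZ hZ' hne) ha
  · simp only [Finset.forall_mem_image, Finset.mem_toLeft]
    intro Z hZ a ha b hab
    exact h.mem_or_mem Z hZ _ ha _ (.inl ((SimpleGraph.map_adj_apply ..).mpr hab))
  · simp only [Finset.forall_mem_image]
    exact fun Z hZ => (Finset.subset_disjSum.mp (h𝒵 Z hZ)).1

theorem exists_isMatching_of_isOddFamily [Finite W]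
    (h : ∀ u 𝒵, IsOddFamily G u 𝒵 → (∀ Z ∈ 𝒵, Z ⊆ T) → #𝒵 ≤ #u) :
    ∃ N : G.Subgraph, N.IsMatching ∧ ∀ x ∈ T, x ∈ N.verts := by
  classical
  have := Fintype.ofFinite W
  obtain ⟨N, hN⟩ := exists_isPerfectMatching_of_isOddFamily (paddedGraph G T) fun u 𝒵 h𝒵 hodd => by
    have h₂ : #{Z ∈ 𝒵 | ¬ Z ⊆ T.disjSum ∅} ≤ 1 := Finset.card_le_one.mpr fun Z hZ Z' hZ' =>
      h𝒵.eq_of_not_subset (Finset.mem_filter.mp hZ).1 (Finset.mem_filter.mp hZ').1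
        (Finset.mem_filter.mp hZ).2 (Finset.mem_filter.mp hZ').2
    obtain ⟨𝒴, h𝒴, h𝒴T, hcard⟩ := (h𝒵.mono (Finset.filter_subset (· ⊆ T.disjSum ∅) _)).exists_toLeft
      fun Z hZ => (Finset.mem_filter.mp hZ).2
    have := h _ 𝒴 h𝒴 h𝒴T
    have := Finset.card_toLeft_le (u := u)
    have hsplit := Finset.card_filter_add_card_filter_not (s := 𝒵) (· ⊆ T.disjSum ∅)
    have hu := Finset.card_compl_add_card u
    rw [Fintype.card_sum] at hu
    rw [Nat.odd_iff, Nat.odd_iff] at hodd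
    lia
  let N' : G.Subgraph :=
    { verts := {a | ∃ b, G.Adj a b ∧ N.Adj (.inl a) (.inl b)}
      Adj a b := G.Adj a b ∧ N.Adj (.inl a) (.inl b)
      adj_sub := And.left
      edge_vert := fun h => ⟨_, h⟩
      symm := ⟨fun _ _ h => ⟨h.1.symm, h.2.symm⟩⟩ }
  refine ⟨N', fun a ⟨b, hb⟩ => ⟨b, hb, fun b' hb' => ?_⟩, fun a ha => ?_⟩
  · exact Sum.inl_injective (hN.1.eq_of_adj_left hb'.2 hb.2)
  · obtain ⟨q, hq, -⟩ := SimpleGraph.Subgraph.isPerfectMatching_iff.mp hN (.inl a)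
    obtain ⟨-, a', b, hab, ha', rfl⟩ | hpad := hq.adj_sub
    · obtain rfl := Sum.inl_injective ha'
      exact ⟨b, hab, hq⟩
    · have := ((SimpleGraph.fromRel_adj ..).mp hpad).2
      simp [ha] at this

end Tutte

/-! ### Splitting a piece with a small edge cut -/

section Cuts

open Classical in
/-- The edges of `D` with one end in `Z` and one end outside `Z`. -/
noncomputable def cutEdges (ends : E → Sym2 V) (D : Finset E) (Z : Finset V) : Finset E :=
  {e ∈ D | (∃ x ∈ Z, x ∈ ends e) ∧ ∃ y ∉ Z, y ∈ ends e}

open Classical in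
/-- The edges of `D` with both ends in `Z`. -/
noncomputable def insideEdges (ends : E → Sym2 V) (D : Finset E) (Z : Finset V) : Finset E :=
  {e ∈ D | ∀ x ∈ ends e, x ∈ Z}

open Classical in
/-- The vertices of `Y` that are not incident with an edge leaving `Y`. -/
noncomputable def innerVertices (ends : E → Sym2 V) (D : Finset E) (Y : Finset V) : Finset V :=
  {x ∈ Y | ∀ e ∈ cutEdges ends D Y, x ∉ ends e}

variable {ends : E → Sym2 V} {D D' : Finset E} {e g : E} {A T Y Z u : Finset V} {x : V}
  {𝒵 : Finset (Finset V)} {k : ℕ}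

theorem mem_cutEdges :
    e ∈ cutEdges ends D Z ↔ e ∈ D ∧ (∃ x ∈ Z, x ∈ ends e) ∧ ∃ y ∉ Z, y ∈ ends e := by
  simp [cutEdges]

theorem mem_insideEdges : e ∈ insideEdges ends D Z ↔ e ∈ D ∧ ∀ x ∈ ends e, x ∈ Z := by
  simp [insideEdges]

theorem mem_innerVertices :
    x ∈ innerVertices ends D Y ↔ x ∈ Y ∧ ∀ e ∈ cutEdges ends D Y, x ∉ ends e := by
  simp [innerVertices]

theorem insideEdges_subset : insideEdges ends D Z ⊆ D := fun _ he => (mem_insideEdges.mp he).1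

theorem cutEdges_subset : cutEdges ends D Z ⊆ D := fun _ he => (mem_cutEdges.mp he).1

theorem disjoint_insideEdges_cutEdges : Disjoint (insideEdges ends D Z) (cutEdges ends D Z) :=
  Finset.disjoint_left.mpr fun e he he' => by
    obtain ⟨-, -, y, hy, hye⟩ := mem_cutEdges.mp he'
    exact hy ((mem_insideEdges.mp he).2 y hye)

theorem exists_mk_of_mem_cutEdges (he : e ∈ cutEdges ends D Z) :
    ∃ a ∈ Z, ∃ b ∉ Z, ends e = s(a, b) := by
  obtain ⟨-, ⟨a, ha, hae⟩, b, hb, hbe⟩ := mem_cutEdges.mp he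
  exact ⟨a, ha, b, hb, (Sym2.mem_and_mem_iff (ne_of_mem_of_not_mem ha hb)).mp ⟨hae, hbe⟩⟩

theorem mem_cutEdges_of_mk {a b : V} (he : e ∈ D) (hab : ends e = s(a, b)) (ha : a ∈ Z)
    (hb : b ∉ Z) : e ∈ cutEdges ends D Z :=
  mem_cutEdges.mpr ⟨he, ⟨a, ha, by simp [hab]⟩, b, hb, by simp [hab]⟩

theorem card_edgesAt_le_of_notMem (hD : DegreeLE ends D (k + 1)) (he : e ∈ edgesAt ends D x)
    (hD' : D' ⊆ D) (heD' : e ∉ D') : #(edgesAt ends D' x) ≤ k := by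
  classical
  have hsub : edgesAt ends D' x ⊆ (edgesAt ends D x).erase e := fun g hg =>
    Finset.mem_erase.mpr
      ⟨ne_of_mem_of_not_mem (mem_edgesAt.mp hg).1 heD', edgesAt_mono hD' x hg⟩
  refine (Finset.card_le_card hsub).trans ?_
  rw [Finset.card_erase_of_mem he]
  exact Nat.sub_le_iff_le_add.mpr (hD x)

open Classical in
theorem odd_card_filter_mem_iff {p : Sym2 V} (hp : ¬ p.IsDiag) :
    Odd #{x ∈ Z | x ∈ p} ↔ (∃ x ∈ Z, x ∈ p) ∧ ∃ y ∉ Z, y ∈ p := by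
  induction p with
  | _ a b =>
    have hab : a ≠ b := hp
    have hinter : {x ∈ Z | x ∈ s(a, b)} = Z ∩ {a, b} := by
      ext x
      simp
    rw [hinter]
    simp only [Sym2.mem_iff, and_or_left, exists_or, exists_eq_right]
    by_cases ha : a ∈ Z <;> by_cases hb : b ∈ Z <;> simp [ha, hb, hab]

theorem odd_card_cutEdges (hloop : ∀ e ∈ D, ¬ (ends e).IsDiag)
    (hdeg : ∀ x ∈ Z, Odd #(edgesAt ends D x)) (hZ : Odd #Z) : Odd #(cutEdges ends D Z) := by
  classical
  have hsum : ∑ x ∈ Z, #(edgesAt ends D x) = ∑ e ∈ D, #{x ∈ Z | x ∈ ends e} := by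
    simp only [edgesAt]
    exact Finset.sum_card_bipartiteAbove_eq_sum_card_bipartiteBelow _
  have hcut : {e ∈ D | Odd #{x ∈ Z | x ∈ ends e}} = cutEdges ends D Z :=
    Finset.filter_congr fun e he => odd_card_filter_mem_iff (hloop e he)
  rw [← hcut, ← Finset.odd_sum_iff_odd_card_odd, ← hsum, Finset.odd_sum_iff_odd_card_odd,
    Finset.filter_true_of_mem hdeg]
  exact hZ

theorem exists_degreeLE_one [Finite V]
    (h : ∀ u 𝒵, IsOddFamily (.fromEdgeSet (ends '' D)) u 𝒵 → (∀ Z ∈ 𝒵, Z ⊆ T) → #𝒵 ≤ #u) :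
    ∃ M ⊆ D, DegreeLE ends M 1 ∧ ∀ x ∈ T, ∃ e ∈ M, x ∈ ends e := by
  classical
  obtain ⟨N, hN, hT⟩ := exists_isMatching_of_isOddFamily h
  obtain ⟨s, hs, hbij⟩ := Set.exists_subset_bijOn {e | e ∈ D ∧ ends e ∈ N.edgeSet} ends
  refine ⟨{e ∈ D | e ∈ s}, Finset.filter_subset _ _, fun x => ?_, fun x hx => ?_⟩
  · refine Finset.card_le_one.mpr fun e he f hf => ?_
    simp only [mem_edgesAt, Finset.mem_filter] at he hf
    obtain ⟨y, hy⟩ := Sym2.mem_iff_exists.mp he.2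
    obtain ⟨z, hz⟩ := Sym2.mem_iff_exists.mp hf.2
    have hxy : N.Adj x y := by simpa [hy] using (hs he.1.2).2
    have hxz : N.Adj x z := by simpa [hz] using (hs hf.1.2).2
    refine hbij.injOn he.1.2 hf.1.2 ?_
    rw [hy, hz, hN.eq_of_adj_left hxy hxz]
  · obtain ⟨y, hxy, -⟩ := hN (hT x hx)
    obtain ⟨⟨e, he, hexy⟩, -⟩ := (SimpleGraph.fromEdgeSet_adj _).mp hxy.adj_sub
    obtain ⟨f, hf, hfe⟩ := hbij.surjOn ⟨e, ⟨he, by simpa [hexy] using hxy⟩, rfl⟩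
    exact ⟨f, Finset.mem_filter.mpr ⟨(hs hf).1, hf⟩, by simp [hfe, hexy]⟩

namespace IsOddFamily

variable (h : IsOddFamily (.fromEdgeSet (ends '' insideEdges ends D A)) u 𝒵)
  (hA : ∀ Z ∈ 𝒵, Z ⊆ A)

include h hA

theorem exists_mk_of_mem_cutEdges (hZ : Z ∈ 𝒵) (he : e ∈ cutEdges ends D Z) :
    ∃ a ∈ Z, ∃ b, ends e = s(a, b) ∧ (b ∈ u ∨ b ∉ A) := by
  obtain ⟨a, ha, b, hb, hab⟩ := StarEdgeColoring.exists_mk_of_mem_cutEdges he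
  refine ⟨a, ha, b, hab, or_iff_not_imp_right.mpr fun hbA => ?_⟩
  rw [not_not] at hbA
  refine (h.mem_or_mem Z hZ a ha b ?_).resolve_left hb
  refine (SimpleGraph.fromEdgeSet_adj _).mpr ⟨⟨e, ?_, hab⟩, ne_of_mem_of_not_mem ha hb⟩
  refine Finset.mem_coe.mpr (mem_insideEdges.mpr ⟨(mem_cutEdges.mp he).1, fun x hx => ?_⟩)
  rw [hab, Sym2.mem_iff] at hx
  obtain rfl | rfl := hx
  exacts [hA Z hZ ha, hbA]

theorem pairwiseDisjoint_cutEdges :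
    (𝒵 : Set (Finset V)).PairwiseDisjoint (cutEdges ends D) := by
  intro Z hZ Z' hZ' hne
  refine Finset.disjoint_left.mpr fun e he he' => ?_
  obtain ⟨a, ha, b, hab, hb⟩ := h.exists_mk_of_mem_cutEdges hA hZ he
  obtain ⟨-, ⟨x, hx, hxe⟩, -⟩ := mem_cutEdges.mp he'
  rw [hab, Sym2.mem_iff] at hxe
  obtain rfl | rfl := hxe
  · exact Finset.disjoint_left.mp (h.pairwiseDisjoint hZ hZ' hne) ha hx
  · exact hb.elim (Finset.disjoint_left.mp (h.disjoint Z' hZ') hx) (· (hA Z' hZ' hx))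

theorem mul_card_le (hD : DegreeLE ends D k) (hcut : ∀ Z ∈ 𝒵, k ≤ #(cutEdges ends D Z)) :
    k * #𝒵 ≤ k * #u + #(cutEdges ends D A) := by
  classical
  have hsub : 𝒵.biUnion (cutEdges ends D) ⊆ u.biUnion (edgesAt ends D) ∪ cutEdges ends D A := by
    refine Finset.biUnion_subset.mpr fun Z hZ e he => ?_
    obtain ⟨a, ha, b, hab, hb | hb⟩ := h.exists_mk_of_mem_cutEdges hA hZ he
    · have hbe : e ∈ edgesAt ends D b := mem_edgesAt.mpr ⟨cutEdges_subset he, by simp [hab]⟩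
      exact Finset.mem_union_left _ (Finset.mem_biUnion.mpr ⟨b, hb, hbe⟩)
    · exact Finset.mem_union_right _ (mem_cutEdges_of_mk (cutEdges_subset he) hab (hA Z hZ ha) hb)
  calc k * #𝒵 = #𝒵 * k := mul_comm _ _
    _ ≤ ∑ Z ∈ 𝒵, #(cutEdges ends D Z) := Finset.card_nsmul_le_sum _ _ _ hcut
    _ = #(𝒵.biUnion (cutEdges ends D)) :=
      (Finset.card_biUnion (h.pairwiseDisjoint_cutEdges hA)).symm
    _ ≤ #(u.biUnion (edgesAt ends D)) + #(cutEdges ends D A) :=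
      (Finset.card_le_card hsub).trans (Finset.card_union_le _ _)
    _ ≤ k * #u + #(cutEdges ends D A) := by
      rw [mul_comm]
      exact Nat.add_le_add_right (Finset.card_biUnion_le_card_mul _ _ _ fun x _ => hD x) _

end IsOddFamily

theorem card_cutEdges_innerVertices_le (hD : DegreeLE ends D (k + 1))
    (hY : #(cutEdges ends D Y) ≤ 1) : #(cutEdges ends D (innerVertices ends D Y)) ≤ k := by
  have key {e} (he : e ∈ cutEdges ends D (innerVertices ends D Y)) :
      ∃ b ∈ Y, b ∈ ends e ∧ e ∉ cutEdges ends D Y ∧ ∃ g ∈ cutEdges ends D Y, b ∈ ends g := by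
    obtain ⟨a, ha, b, hb, hab⟩ := exists_mk_of_mem_cutEdges he
    obtain ⟨haY, hacut⟩ := mem_innerVertices.mp ha
    have hecut : e ∉ cutEdges ends D Y := fun hecut => hacut e hecut (by simp [hab])
    have hbY : b ∈ Y := by
      by_contra hbY
      exact hecut (mem_cutEdges_of_mk (cutEdges_subset he) hab haY hbY)
    refine ⟨b, hbY, by simp [hab], hecut, ?_⟩
    simpa [mem_innerVertices, hbY] using hb
  obtain hempty | ⟨e, he⟩ := (cutEdges ends D (innerVertices ends D Y)).eq_empty_or_nonempty
  · simp [hempty]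
  obtain ⟨-, -, -, -, g, hg, -⟩ := key he
  obtain ⟨a, -, c, hcY, hac⟩ := exists_mk_of_mem_cutEdges hg
  have eq_a {x} (hx : x ∈ Y) (hxg : x ∈ ends g) : x = a := by
    rw [hac, Sym2.mem_iff] at hxg
    exact hxg.resolve_right fun h => hcY (h ▸ hx)
  have hga : g ∈ edgesAt ends D a := mem_edgesAt.mpr ⟨cutEdges_subset hg, by simp [hac]⟩
  have hsub : cutEdges ends D (innerVertices ends D Y) ⊆
      edgesAt ends (cutEdges ends D (innerVertices ends D Y)) a := fun f hf => by
    obtain ⟨b, hbY, hbf, -, g', hg', hbg'⟩ := key hf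
    obtain rfl := Finset.card_le_one.mp hY g hg g' hg'
    exact mem_edgesAt.mpr ⟨hf, eq_a hbY hbg' ▸ hbf⟩
  refine (Finset.card_le_card hsub).trans
    (card_edgesAt_le_of_notMem hD hga cutEdges_subset fun hg' => ?_)
  obtain ⟨-, -, -, hg'', -⟩ := key hg'
  exact hg'' hg

theorem degreeLE_one_union_cutEdges [DecidableEq E] {M : Finset E}
    (hY : #(cutEdges ends D Y) ≤ 1) (hM : DegreeLE ends M 1)
    (hMD : M ⊆ insideEdges ends D (innerVertices ends D Y)) :
    DegreeLE ends (M ∪ cutEdges ends D Y) 1 := fun x => by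
  have hcross {e f} (he : e ∈ M) (hf : f ∈ cutEdges ends D Y) (hxe : x ∈ ends e) : x ∉ ends f :=
    (mem_innerVertices.mp ((mem_insideEdges.mp (hMD he)).2 x hxe)).2 f hf
  refine Finset.card_le_one.mpr fun e he f hf => ?_
  simp only [mem_edgesAt, Finset.mem_union] at he hf
  obtain ⟨he | he, hxe⟩ := he <;> obtain ⟨hf | hf, hxf⟩ := hf
  · exact hM.eq_of_mem he hf hxe hxf
  · exact (hcross he hf hxe hxf).elim
  · exact (hcross hf he hxf hxe).elim
  · exact Finset.card_le_one.mp hY e he f hf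

variable (hD : DegreeLE ends D 3) (hloop : ∀ e ∈ D, ¬ (ends e).IsDiag)
  (hY : #(cutEdges ends D Y) ≤ 1) (hmin : ∀ Z ⊂ Y, Z.Nonempty → 2 ≤ #(cutEdges ends D Z))

include hloop hmin in
theorem three_le_card_cutEdges (hdeg : ∀ x ∈ Z, #(edgesAt ends D x) = 3) (hZodd : Odd #Z)
    (hZY : Z ⊆ innerVertices ends D Y) : 3 ≤ #(cutEdges ends D Z) := by
  have hodd : Odd #(cutEdges ends D Z) :=
    odd_card_cutEdges hloop (fun x hx => hdeg x hx ▸ by decide) hZodd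
  have hne : Z ≠ Y := by
    rintro rfl
    obtain ⟨e, he⟩ := Finset.card_pos.mp hodd.pos
    obtain ⟨a, ha, b, -, hab⟩ := exists_mk_of_mem_cutEdges he
    exact (mem_innerVertices.mp (hZY ha)).2 e he (by simp [hab])
  have hss : Z ⊂ Y :=
    Finset.ssubset_iff_subset_ne.mpr ⟨fun x hx => (mem_innerVertices.mp (hZY hx)).1, hne⟩
  have := hmin Z hss (Finset.card_pos.mp hZodd.pos)
  obtain ⟨k, hk⟩ := hodd
  lia

include hD hloop hY hmin

theorem exists_matching_innerVertices [Finite V] :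
    ∃ M ⊆ insideEdges ends D (innerVertices ends D Y), DegreeLE ends M 1 ∧
      ∀ x ∈ innerVertices ends D Y, #(edgesAt ends D x) = 3 → ∃ e ∈ M, x ∈ ends e := by
  obtain ⟨M, hMD, hM, hcover⟩ := exists_degreeLE_one (ends := ends)
    (D := insideEdges ends D (innerVertices ends D Y))
    (T := {x ∈ innerVertices ends D Y | #(edgesAt ends D x) = 3}) fun u 𝒵 h h𝒵 => by
      have hcut : ∀ Z ∈ 𝒵, 3 ≤ #(cutEdges ends D Z) := fun Z hZ =>
        three_le_card_cutEdges hloop hmin (fun x hx => (Finset.mem_filter.mp (h𝒵 Z hZ hx)).2)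
          (h.odd Z hZ) ((h𝒵 Z hZ).trans (Finset.filter_subset _ _))
      have := h.mul_card_le (fun Z hZ => (h𝒵 Z hZ).trans (Finset.filter_subset _ _)) hD hcut
      have := card_cutEdges_innerVertices_le hD hY
      lia
  exact ⟨M, hMD, hM, fun x hx hx₃ => hcover x (Finset.mem_filter.mpr ⟨hx, hx₃⟩)⟩

theorem exists_isSplitting [Finite V] [DecidableEq E] :
    ∃ M F, IsSplitting ends M F ∧ M ∪ F = insideEdges ends D Y ∪ cutEdges ends D Y ∧
      cutEdges ends D Y ⊆ M := by
  obtain ⟨M, hMD, hM, hcover⟩ := exists_matching_innerVertices hD hloop hY hmin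
  have hMY : M ⊆ insideEdges ends D Y := hMD.trans fun e he => mem_insideEdges.mpr
    ⟨insideEdges_subset he, fun x hx =>
      (mem_innerVertices.mp ((mem_insideEdges.mp he).2 x hx)).1⟩
  have hMF : Disjoint (M ∪ cutEdges ends D Y) (insideEdges ends D Y \ M) :=
    Finset.disjoint_union_left.mpr ⟨Finset.disjoint_sdiff,
      disjoint_insideEdges_cutEdges.symm.mono_right Finset.sdiff_subset⟩
  have hFD : insideEdges ends D Y \ M ⊆ D := Finset.sdiff_subset.trans insideEdges_subset
  refine ⟨M ∪ cutEdges ends D Y, insideEdges ends D Y \ M,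
    ⟨degreeLE_one_union_cutEdges hY hM hMD, fun x => ?_, hMF⟩,
    by rw [Finset.union_right_comm, Finset.union_sdiff_of_subset hMY], Finset.subset_union_right⟩
  by_cases hx : ∃ e ∈ M ∪ cutEdges ends D Y, x ∈ ends e
  · obtain ⟨e, he, hxe⟩ := hx
    have heD : e ∈ D := Finset.union_subset (hMY.trans insideEdges_subset) cutEdges_subset he
    exact card_edgesAt_le_of_notMem hD (mem_edgesAt.mpr ⟨heD, hxe⟩) hFD
      (Finset.disjoint_left.mp hMF he)
  obtain hempty | ⟨f, hf⟩ := (edgesAt ends (insideEdges ends D Y \ M) x).eq_empty_or_nonempty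
  · simp [hempty]
  obtain ⟨hfF, hxf⟩ := mem_edgesAt.mp hf
  have hxinner : x ∈ innerVertices ends D Y := mem_innerVertices.mpr
    ⟨(mem_insideEdges.mp (Finset.sdiff_subset hfF)).2 x hxf,
      fun e he hxe => hx ⟨e, Finset.mem_union_right _ he, hxe⟩⟩
  have hx₃ : #(edgesAt ends D x) ≠ 3 := fun h =>
    let ⟨e, he, hxe⟩ := hcover x hxinner h
    hx ⟨e, Finset.mem_union_left _ he, hxe⟩
  have := Finset.card_le_card (edgesAt_mono (ends := ends) hFD x)
  have := hD x
  lia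

end Cuts

/-! ### Subcubic multigraphs -/

section Subcubic

variable {ends : E → Sym2 V} {D P S T : Finset E} {Y : Finset V} {L : E → Finset C} {σ : E → C}

theorem isStarOn_union_of_isStrongAt [DecidableEq E] (hS : IsStarOn ends S σ)
    (hT : IsStarOn ends T σ) (hP : #P ≤ 1)
    (htouch : ∀ e ∈ S, ∀ f ∈ T, Touch ends e f → f ∈ P)
    (hPS : ∀ e ∈ P, IsStrongAt ends (S ∪ P) σ e) (hPT : ∀ e ∈ P, IsStrongAt ends T σ e) :
    IsStarOn ends (S ∪ T) σ := by
  refine isStarOn_of_isStrongAt (T := P) (fun e he h hh => ?_) ?_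
  · obtain ⟨hhST, hhe, g, hg, heg, hgh⟩ := mem_near.mp hh
    have eq_e {f} (hf : f ∈ P) : f = e := Finset.card_le_one.mp hP f hf e he
    have heSP : e ∈ S ∪ P := Finset.mem_union_right S he
    obtain hhS | hhT := Finset.mem_union.mp hhST
    · have hhSP : h ∈ S ∪ P := Finset.mem_union_left P hhS
      obtain hgS | hgT := Finset.mem_union.mp hg
      · exact (hPS e he).ne hhSP (Finset.mem_union_left P hgS) hhe heg hgh
      · obtain rfl := eq_e (htouch h hhS g hgT hgh.symm)
        exact (hPS g he).ne hhSP heSP hhe heg hgh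
    · obtain hgS | hgT := Finset.mem_union.mp hg
      · exact (hhe (eq_e (htouch g hgS h hhT hgh))).elim
      · exact (hPT e he).ne hhT hgT hhe heg hgh
  · rw [Finset.union_sdiff_distrib]
    refine isStarOn_union (hS.mono Finset.sdiff_subset) (hT.mono Finset.sdiff_subset)
      fun e he f hf hef => (Finset.mem_sdiff.mp hf).2 ?_
    exact htouch e (Finset.mem_sdiff.mp he).1 f (Finset.mem_sdiff.mp hf).1 hef

theorem notMem_of_mem_sdiff [DecidableEq E] {e : E} {x : V}
    (he : e ∈ D \ (insideEdges ends D Y ∪ cutEdges ends D Y)) (hx : x ∈ ends e) : x ∉ Y := by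
  intro hxY
  simp only [Finset.mem_sdiff, Finset.mem_union, mem_insideEdges, mem_cutEdges] at he
  obtain ⟨heD, hnot⟩ := he
  refine hnot (or_iff_not_imp_left.mpr fun _ => ⟨heD, ⟨x, hxY, hx⟩, ?_⟩)
  grind

theorem exists_isStrongAt_cutEdges [DecidableEq E] (hD : DegreeLE ends D 3)
    (hL : ∀ e ∈ D, 7 ≤ #(L e)) (hY : #(cutEdges ends D Y) ≤ 1)
    (hS : S ⊆ D) (hSY : ∀ e ∈ S, ∀ x ∈ ends e, x ∉ Y) (σ : E → C) :
    ∃ τ, (∀ e ∈ S, τ e = σ e) ∧ ∀ e ∈ cutEdges ends D Y, τ e ∈ L e ∧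
      IsStrongAt ends (S ∪ cutEdges ends D Y) τ e := by
  obtain hempty | ⟨e, he⟩ := (cutEdges ends D Y).eq_empty_or_nonempty
  · exact ⟨σ, fun _ _ => rfl, by simp [hempty]⟩
  have eq_e {f} (hf : f ∈ cutEdges ends D Y) : f = e := Finset.card_le_one.mp hY f hf e he
  obtain ⟨heD, ⟨u, hu, hue⟩, -⟩ := mem_cutEdges.mp he
  have hSD : S ∪ cutEdges ends D Y ⊆ D := Finset.union_subset hS cutEdges_subset
  have hnear := card_near_le_of_leaf (k := 2) subset_rfl (Finset.mem_union_right S he)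
    (hD.mono hSD) (hD.mono hSD) hue fun g hg hug =>
      (Finset.mem_union.mp hg).elim (fun hgS => (hSY g hgS u hug hu).elim) eq_e
  obtain ⟨z, hz, hstrong⟩ := exists_isStrongAt_update σ (hnear.trans_lt (hL e heD))
  refine ⟨Function.update σ e z, fun f hf => Function.update_of_ne ?_ z σ, fun f hf => ?_⟩
  · rintro rfl
    exact hSY f hf u hue hu
  · obtain rfl := eq_e hf
    exact ⟨by rwa [Function.update_self], hstrong⟩

theorem exists_isStarOn_of_cutEdges [Finite V] [DecidableEq E] (hD : DegreeLE ends D 3)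
    (hloop : ∀ e ∈ D, ¬ (ends e).IsDiag) (hL : ∀ e ∈ D, 7 ≤ #(L e))
    (hY : #(cutEdges ends D Y) ≤ 1) (hmin : ∀ Z ⊂ Y, Z.Nonempty → 2 ≤ #(cutEdges ends D Z))
    (hσ : IsStarOn ends (D \ (insideEdges ends D Y ∪ cutEdges ends D Y)) σ)
    (hσL : ∀ e ∈ D \ (insideEdges ends D Y ∪ cutEdges ends D Y), σ e ∈ L e) :
    ∃ τ, IsStarOn ends D τ ∧ ∀ e ∈ D, τ e ∈ L e := by
  obtain ⟨M, F, hsplit, hMF, hcut⟩ := exists_isSplitting hD hloop hY hmin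
  rw [← hMF] at hσ hσL
  have hMFD : M ∪ F ⊆ D := hMF ▸ Finset.union_subset insideEdges_subset cutEdges_subset
  have hSY (e) (he : e ∈ D \ (M ∪ F)) (x) (hx : x ∈ ends e) : x ∉ Y :=
    notMem_of_mem_sdiff (hMF ▸ he) hx
  obtain ⟨ρ, hρσ, hρ⟩ := exists_isStrongAt_cutEdges hD hL hY Finset.sdiff_subset hSY σ
  obtain ⟨τ, hτ, hτM, hτρ, hτL⟩ := hsplit.exists_isStarOn
    (fun e he => hloop e (hMFD (Finset.mem_union_right M he)))
    (fun e he => hL e (hMFD (Finset.mem_union_right M he))) hcut hY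
    (fun e he _ => hL e (hMFD (Finset.mem_union_left F he))) ρ
  let κ (e : E) : C := if e ∈ M ∪ F then τ e else σ e
  have κ_MF (e) (he : e ∈ M ∪ F) : τ e = κ e := (if_pos he).symm
  have κ_rest (e) (he : e ∈ D \ (M ∪ F)) : σ e = κ e := (if_neg (Finset.mem_sdiff.mp he).2).symm
  have hcutMF : cutEdges ends D Y ⊆ M ∪ F := hcut.trans Finset.subset_union_left
  refine ⟨κ, ?_, fun e he => ?_⟩
  · rw [← Finset.sdiff_union_of_subset hMFD]
    refine isStarOn_union_of_isStrongAt (hσ.congr κ_rest) (hτ.congr κ_MF) hY ?_ ?_ ?_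
    · rintro e he f hf ⟨x, hxe, hxf⟩
      refine (Finset.mem_union.mp (hMF ▸ hf)).resolve_left fun hf => hSY e he x hxe ?_
      exact (mem_insideEdges.mp hf).2 x hxf
    · refine fun e he => (hρ e he).2.congr (Finset.mem_union_right _ he) fun f hf => ?_
      obtain hf | hf := Finset.mem_union.mp hf
      · rw [hρσ f hf, κ_rest f hf]
      · rw [← hτρ f hf, κ_MF f (hcutMF hf)]
    · exact fun e he => (hτM e (hcut he)).congr (hcutMF he) κ_MF
  · by_cases heMF : e ∈ M ∪ F
    · rw [← κ_MF e heMF]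
      by_cases hecut : e ∈ cutEdges ends D Y
      · exact hτρ e hecut ▸ (hρ e hecut).1
      · exact hτL e heMF hecut
    · have he' := Finset.mem_sdiff.mpr ⟨he, heMF⟩
      exact κ_rest e he' ▸ hσL e he'

theorem exists_minimal_cutEdges {X : Finset V} (hX : X.Nonempty)
    (hDX : ∀ e ∈ D, ∀ x ∈ ends e, x ∈ X) :
    ∃ Y ⊆ X, Y.Nonempty ∧ #(cutEdges ends D Y) ≤ 1 ∧
      ∀ Z ⊂ Y, Z.Nonempty → 2 ≤ #(cutEdges ends D Z) := by
  have hXcut : cutEdges ends D X = ∅ := Finset.eq_empty_of_forall_notMem fun e he => by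
    obtain ⟨heD, -, y, hy, hye⟩ := mem_cutEdges.mp he
    exact hy (hDX e heD y hye)
  obtain ⟨Y, hYX, ⟨hne, hY⟩, hmin⟩ := exists_minimal_le_of_wellFoundedLT
    (fun Y : Finset V => Y.Nonempty ∧ #(cutEdges ends D Y) ≤ 1) X ⟨hX, by simp [hXcut]⟩
  refine ⟨Y, hYX, hne, hY, fun Z hZ hZne => ?_⟩
  by_contra! hlt
  exact hZ.2 (hmin ⟨hZne, Nat.le_of_lt_succ hlt⟩ hZ.1)

theorem exists_isStarOn_of_degreeLE_three [Finite V] [Nonempty (E → C)]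
    (hD : DegreeLE ends D 3) (hloop : ∀ e ∈ D, ¬ (ends e).IsDiag) (hL : ∀ e ∈ D, 7 ≤ #(L e)) :
    ∃ σ, IsStarOn ends D σ ∧ ∀ e ∈ D, σ e ∈ L e := by
  classical
  have := Fintype.ofFinite V
  obtain ⟨X, hDX⟩ : ∃ X : Finset V, ∀ e ∈ D, ∀ x ∈ ends e, x ∈ X := ⟨Finset.univ, by simp⟩
  induction X using Finset.strongInduction generalizing D with
  | H X ih =>
  obtain rfl | hX := X.eq_empty_or_nonempty
  · obtain rfl : D = ∅ := Finset.eq_empty_of_forall_notMem fun e he => by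
      obtain ⟨x, hx, -⟩ := Touch.refl (ends := ends) e
      simpa using hDX e he x hx
    exact ⟨Classical.arbitrary _, ⟨by simp, by simp⟩, by simp⟩
  obtain ⟨Y, hYX, hYne, hY, hmin⟩ := exists_minimal_cutEdges hX hDX
  have hsub : D \ (insideEdges ends D Y ∪ cutEdges ends D Y) ⊆ D := Finset.sdiff_subset
  obtain ⟨σ, hσ, hσL⟩ := ih (X \ Y) (Finset.sdiff_ssubset hYX hYne) (hD.mono hsub)
    (fun e he => hloop e (hsub he)) (fun e he => hL e (hsub he)) fun e he x hx =>
      Finset.mem_sdiff.mpr ⟨hDX e (hsub he) x hx, notMem_of_mem_sdiff he hx⟩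
  exact exists_isStarOn_of_cutEdges hD hloop hL hY hmin hσ hσL

end Subcubic

/-! ### Star edge-colorings of `Graph` -/

section Multigraph

variable {α β : Type*} {G : Graph α β}

theorem encard_incidenceSet_le {n : ℕ∞} (hdeg : G.maxDegree ≤ n) {x : α} (hx : x ∈ G.vertexSet) :
    (G.incidenceSet x).encard ≤ n :=
  le_self_add.trans ((le_iSup₂ (f := fun x (_ : x ∈ G.vertexSet) => G.degree x) x hx).trans hdeg)

theorem finite_edgeSet {n : ℕ} (hfin : G.vertexSet.Finite) (hdeg : G.maxDegree ≤ n) :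
    G.edgeSet.Finite := by
  refine (hfin.biUnion fun x hx => Set.finite_of_encard_le_coe
    (encard_incidenceSet_le hdeg hx)).subset fun e he => ?_
  obtain ⟨x, y, h⟩ := G.exists_isLink_of_mem_edgeSet he
  exact Set.mem_biUnion h.left_mem ⟨y, h⟩

theorem exists_isLink (e : G.edgeSet) : ∃ p : G.vertexSet × G.vertexSet, G.IsLink e p.1 p.2 := by
  obtain ⟨x, y, h⟩ := G.exists_isLink_of_mem_edgeSet e.2
  exact ⟨⟨⟨x, h.left_mem⟩, ⟨y, h.right_mem⟩⟩, h⟩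

variable (G) in
/-- The unordered pair of ends of each edge of `G`: this presents `G` in the form used for
colorings of sets of edges above. -/
noncomputable def edgeEnds (e : G.edgeSet) : Sym2 G.vertexSet :=
  s((exists_isLink e).choose.1, (exists_isLink e).choose.2)

theorem edgeEnds_eq_iff {e : G.edgeSet} {x y : G.vertexSet} :
    edgeEnds G e = s(x, y) ↔ G.IsLink e x y := by
  have hp := (exists_isLink e).choose_spec
  rw [edgeEnds, Sym2.eq_iff, Subtype.ext_iff, Subtype.ext_iff, Subtype.ext_iff, Subtype.ext_iff]
  refine ⟨?_, hp.eq_and_eq_or_eq_and_eq⟩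
  rintro (⟨hx, hy⟩ | ⟨hx, hy⟩)
  · exact hx ▸ hy ▸ hp
  · exact hx ▸ hy ▸ hp.symm

theorem mem_edgeEnds {e : G.edgeSet} {x : G.vertexSet} : x ∈ edgeEnds G e ↔ G.Inc e x := by
  constructor
  · rintro ⟨y, h⟩
    exact ⟨y, edgeEnds_eq_iff.mp h⟩
  · rintro ⟨y, h⟩
    exact ⟨⟨y, h.right_mem⟩, edgeEnds_eq_iff.mpr h⟩

theorem not_isDiag_edgeEnds (hloop : G.Loopless) (e : G.edgeSet) : ¬ (edgeEnds G e).IsDiag := by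
  obtain ⟨⟨x, y⟩, h⟩ := exists_isLink e
  rw [edgeEnds_eq_iff.mpr h, Sym2.mk_isDiag_iff]
  exact fun hxy => h.ne (congrArg Subtype.val hxy)

theorem degreeLE_edgeEnds {k : ℕ} (hdeg : G.maxDegree ≤ k) (D : Finset G.edgeSet) :
    DegreeLE (edgeEnds G) D k := by
  intro x
  have hsub : Subtype.val '' (edgesAt (edgeEnds G) D x : Set G.edgeSet) ⊆ G.incidenceSet x := by
    rintro _ ⟨e, he, rfl⟩
    exact mem_edgeEnds.mp (mem_edgesAt.mp he).2
  have hcard := (Set.encard_le_encard hsub).trans (encard_incidenceSet_le hdeg x.2)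
  rw [Subtype.val_injective.encard_image, Set.encard_coe_eq_coe_finsetCard] at hcard
  exact_mod_cast hcard

theorem isQuad_edgeEnds {e : Fin 4 → G.edgeSet} (he : Function.Injective e) {v w x y z : α}
    (h₀ : G.IsLink (e 0) v w) (h₁ : G.IsLink (e 1) w x) (h₂ : G.IsLink (e 2) x y)
    (h₃ : G.IsLink (e 3) y z) : IsQuad (edgeEnds G) (e 0) (e 1) (e 2) (e 3) :=
  ⟨⟨w, h₁.left_mem⟩, ⟨x, h₂.left_mem⟩, ⟨y, h₃.left_mem⟩, mem_edgeEnds.mpr ⟨v, h₀.symm⟩,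
    edgeEnds_eq_iff.mpr h₁, edgeEnds_eq_iff.mpr h₂, mem_edgeEnds.mpr ⟨z, h₃⟩,
    he.ne (by decide), he.ne (by decide), he.ne (by decide), he.ne (by decide), he.ne (by decide)⟩

theorem isQuad_of_isFourPath {e : Fin 4 → G.edgeSet} (h : G.IsFourPath e) :
    IsQuad (edgeEnds G) (e 0) (e 1) (e 2) (e 3) := by
  obtain ⟨x, hx, he⟩ := h
  refine isQuad_edgeEnds (fun i j hij => ?_) (he 0) (he 1) (he 2) (he 3)
  rcases (he i).eq_and_eq_or_eq_and_eq (hij ▸ he j) with ⟨h, -⟩ | ⟨h, h'⟩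
  · exact Fin.castSucc_injective _ (hx h)
  · have h₁ := congrArg Fin.val (hx h)
    have h₂ := congrArg Fin.val (hx h')
    simp only [Fin.val_castSucc, Fin.val_succ] at h₁ h₂
    omega

theorem isQuad_of_isFourCycle {e : Fin 4 → G.edgeSet} (h : G.IsFourCycle e) :
    IsQuad (edgeEnds G) (e 0) (e 1) (e 2) (e 3) := by
  obtain ⟨x, hx, he⟩ := h
  refine isQuad_edgeEnds (fun i j hij => ?_) (he 0) (he 1) (he 2) (he 3)
  rcases (he i).eq_and_eq_or_eq_and_eq (hij ▸ he j) with ⟨h, -⟩ | ⟨h, h'⟩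
  · exact hx h
  · have h₁ := hx h
    have h₂ := hx h'
    omega

variable [Fintype G.edgeSet] {σ : G.edgeSet → C}

theorem IsStarOn.not_isBichromatic (hσ : IsStarOn (edgeEnds G) Finset.univ σ)
    {e : Fin 4 → G.edgeSet} (h : IsQuad (edgeEnds G) (e 0) (e 1) (e 2) (e 3)) :
    ¬ Graph.IsBichromatic σ e := by
  rintro ⟨a, b, hab⟩
  obtain ⟨t₀₁, t₁₂, t₂₃⟩ := h.touch
  have quad := hσ.quad _ (Finset.mem_univ _) _ (Finset.mem_univ _) _
    (Finset.mem_univ _) _ (Finset.mem_univ _) h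
  have ne (i j : Fin 4) := hσ.ne (e i) (Finset.mem_univ _) (e j) (Finset.mem_univ _)
  obtain ⟨-, -, -, -, -, -, -, n₀₁, n₁₂, n₂₃, -⟩ := h
  grind [hab 0, hab 1, hab 2, hab 3, ne 0 1 n₀₁ t₀₁, ne 1 2 n₁₂ t₁₂, ne 2 3 n₂₃ t₂₃]

theorem IsStarOn.isStarEdgeColoring (hσ : IsStarOn (edgeEnds G) Finset.univ σ) :
    G.IsStarEdgeColoring σ where
  proper e f x hef he hf := hσ.ne e (Finset.mem_univ e) f (Finset.mem_univ f) hef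
    ⟨⟨x, he.vertex_mem⟩, mem_edgeEnds.mpr he, mem_edgeEnds.mpr hf⟩
  not_path _ h := hσ.not_isBichromatic (isQuad_of_isFourPath h)
  not_cycle _ h := hσ.not_isBichromatic (isQuad_of_isFourCycle h)

end Multigraph

end StarEdgeColoring

theorem theorem1p5 {α : Type u} {β : Type v} (G : Graph α β) (hfin : G.vertexSet.Finite)
    (hloop : G.Loopless) (hdeg : G.maxDegree ≤ 3) :
    Graph.IsStarEdgeChoosable.{u, v, w} G 7 ∧
      Graph.listStarChromaticIndex.{u, v, w} G ≤ 7 := by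
  have h : Graph.IsStarEdgeChoosable.{u, v, w} G 7 := by
    intro C L hL
    have := hfin.to_subtype
    have := (StarEdgeColoring.finite_edgeSet hfin hdeg).fintype
    have : Nonempty (G.edgeSet → C) :=
      ⟨fun e => (Finset.card_pos.mp (Nat.zero_lt_of_lt (hL e))).choose⟩
    obtain ⟨σ, hσ, hσL⟩ := StarEdgeColoring.exists_isStarOn_of_degreeLE_three
      (StarEdgeColoring.degreeLE_edgeEnds hdeg Finset.univ)
      (fun e _ => StarEdgeColoring.not_isDiag_edgeEnds hloop e) (fun e _ => hL e)
    exact ⟨σ, hσ.isStarEdgeColoring, fun e => hσL e (Finset.mem_univ e)⟩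
  exact ⟨h, iInf₂_le (f := fun (k : ℕ) (_ : Graph.IsStarEdgeChoosable.{u, v, w} G k) =>
    (k : ℕ∞)) 7 h⟩
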